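/- Let $\hbar\in(0,1]$. For $d\ge 1$, $g\in\mathcal S(\mathbb R^d)$ and $f\in\mathcal S'(\mathbb R^d)$ put $$V_gf(x,\xi)=f\big(\overline{\pi(x,\xi)g}\big),\qquad \pi(x,\xi)g(y)=(2\pi\hbar)^{-d/2}e^{\frac i\hbar \xi\cdot y}g(y-x),\qquad x,\xi\in\mathbb R^d,$$ $$\|f\|_{M^{\infty,1}_{(g)}(\mathbb R^d)}=\int_{\mathbb R^d}\sup_{x\in\mathbb R^d}|V_gf(x,\xi)|\,d\xi\in[0,\infty],$$ and let $M^{\infty,1}(\mathbb R^d)$ be the set of those $f\in\mathcal S'(\mathbb R^d)$ such that $\|f\|_{M^{\infty,1}_{(g)}(\mathbb R^d)}<\infty$ for some $g\in\mathcal S(\mathbb R^d)\setminus\{0\}$. Let $1\le m<n$ and write $x=(x',x'')\in\mathbb R^m\times\mathbb R^{n-m}=\mathbb R^n$. Let $g'\in\mathcal S(\mathbb R^m)\setminus\{0\}$ be any window, let $q_{m+1},\dots,q_n>0$, $Q=\mathrm{diag}(q_{m+1},\dots,q_n)$, and $$g''(x'')=(2\pi\hbar)^{-(n-m)/2}e^{-\frac1{2\hbar}\langle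 x'',Qx''\rangle},\qquad (g'\otimes g'')(x',x'')=g'(x')\,g''(x'').$$ Then every $f\in M^{\infty,1}(\mathbb R^n)$ is given by integration against a unique bounded continuous function, again denoted by $f$; its restriction $f|_{\mathbb R^m}(x')=f(x',0)$ belongs to $M^{\infty,1}(\mathbb R^m)$, and $$\|f|_{\mathbb R^m}\|_{M^{\infty,1}_{(g')}(\mathbb R^m)}\le\|f\|_{M^{\infty,1}_{(g'\otimes g'')}(\mathbb R^n)}.$$ Moreover the constant $1$ is sharp: if $C\in[0,\infty]$ satisfies $\|f|_{\mathbb R^m}\|_{M^{\infty,1}_{(g')}(\mathbb R^m)}\le C\,\|f\|_{M^{\infty,1}_{(g'\otimes g'')}(\mathbb R^n)}$ for all $f\in M^{\infty,1}(\mathbb R^n)$, then $C\ge1$. -/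

import Mathlib

open MeasureTheory
open scoped SchwartzMap ENNReal BoundedContinuousFunction

noncomputable section

/-- The coordinates `x' = (x₁, …, x_m)` of `x = (x', x'') ∈ ℝ^{m+k}`. -/
def headCLM (m k : ℕ) :
    EuclideanSpace ℝ (Fin (m + k)) →L[ℝ] EuclideanSpace ℝ (Fin m) :=
  LinearMap.toContinuousLinearMap
    { toFun := fun x => WithLp.toLp 2 fun i => x (Fin.castAdd k i)
      map_add' := fun _ _ => rfl
      map_smul' := fun _ _ => rfl }

/-- The coordinates `x'' = (x_{m+1}, …, x_{m+k})` of `x = (x', x'') ∈ ℝ^{m+k}`. -/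
def tailCLM (m k : ℕ) :
    EuclideanSpace ℝ (Fin (m + k)) →L[ℝ] EuclideanSpace ℝ (Fin k) :=
  LinearMap.toContinuousLinearMap
    { toFun := fun x => WithLp.toLp 2 fun j => x (Fin.natAdd m j)
      map_add' := fun _ _ => rfl
      map_smul' := fun _ _ => rfl }

/-- The inclusion `x' ↦ (x', 0)` of `ℝ^m` into `ℝ^{m+k}`. -/
def inclHead (m k : ℕ) (x : EuclideanSpace ℝ (Fin m)) : EuclideanSpace ℝ (Fin (m + k)) :=
  WithLp.toLp 2 (Fin.append (fun i => x i) (fun _ : Fin k => (0 : ℝ)))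

theorem headCLM_apply (m k : ℕ) (x : EuclideanSpace ℝ (Fin (m + k))) (i : Fin m) :
    headCLM m k x i = x (Fin.castAdd k i) := rfl

theorem tailCLM_apply (m k : ℕ) (x : EuclideanSpace ℝ (Fin (m + k))) (j : Fin k) :
    tailCLM m k x j = x (Fin.natAdd m j) := rfl

theorem continuous_inclHead (m k : ℕ) : Continuous (inclHead m k) := by
  refine (PiLp.continuous_toLp 2 _).comp (continuous_pi fun i => ?_)
  refine Fin.addCases (fun i => ?_) (fun j => ?_) i
  · simp only [Fin.append_left]; fun_prop
  · simp only [Fin.append_right]; fun_prop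

theorem norm_le_head_add_tail (m k : ℕ) (x : EuclideanSpace ℝ (Fin (m + k))) :
    ‖x‖ ≤ ‖headCLM m k x‖ + ‖tailCLM m k x‖ := by
  have h : ‖x‖ ^ 2 = ‖headCLM m k x‖ ^ 2 + ‖tailCLM m k x‖ ^ 2 := by
    simp [EuclideanSpace.norm_sq_eq, Fin.sum_univ_add, headCLM_apply, tailCLM_apply]
  have h1 := norm_nonneg (headCLM m k x)
  have h2 := norm_nonneg (tailCLM m k x)
  nlinarith [norm_nonneg x, mul_nonneg h1 h2]

/-- The restriction of a bounded continuous function on `ℝ^{m+k}` to `ℝ^m`, regarded as a subspace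
through `x' ↦ (x', 0)`. -/
def restrictHead (m k : ℕ) (F : EuclideanSpace ℝ (Fin (m + k)) →ᵇ ℂ) :
    EuclideanSpace ℝ (Fin m) →ᵇ ℂ :=
  F.compContinuous ⟨inclHead m k, continuous_inclHead m k⟩

theorem restrictHead_apply (m k : ℕ) (F : EuclideanSpace ℝ (Fin (m + k)) →ᵇ ℂ)
    (x : EuclideanSpace ℝ (Fin m)) : restrictHead m k F x = F (inclHead m k x) := rfl

theorem SchwartzMap.decay_comp_clm {E F : Type*} [NormedAddCommGroup E] [NormedSpace ℝ E]
    [NormedAddCommGroup F] [NormedSpace ℝ F] (g : 𝓢(F, ℂ)) (L : E →L[ℝ] F) (p i : ℕ) :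
    ∃ C : ℝ, 0 ≤ C ∧
      ∀ x, (1 + ‖L x‖) ^ p * ‖iteratedFDeriv ℝ i (fun y => g (L y)) x‖ ≤ C := by
  set S := (2 : ℝ) ^ p * (Finset.Iic (p, i)).sup (fun m => SchwartzMap.seminorm ℝ m.1 m.2) g
  have hS : ∀ y, (1 + ‖y‖) ^ p * ‖iteratedFDeriv ℝ i g y‖ ≤ S := fun y =>
    SchwartzMap.one_add_le_sup_seminorm_apply (𝕜 := ℝ) (m := (p, i)) le_rfl le_rfl g y
  have hS0 : 0 ≤ S := le_trans (by positivity) (hS 0)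
  refine ⟨S * ‖L‖ ^ i, by positivity, fun x => ?_⟩
  have h1 : iteratedFDeriv ℝ i (fun y => g (L y)) x =
      (iteratedFDeriv ℝ i g (L x)).compContinuousLinearMap fun _ => L :=
    L.iteratedFDeriv_comp_right (g.smooth ⊤) x (mod_cast le_top)
  have h2 : ‖iteratedFDeriv ℝ i (fun y => g (L y)) x‖ ≤
      ‖iteratedFDeriv ℝ i g (L x)‖ * ‖L‖ ^ i := by
    rw [h1]
    refine (ContinuousMultilinearMap.norm_compContinuousLinearMap_le _ _).trans_eq ?_
    simp
  calc (1 + ‖L x‖) ^ p * ‖iteratedFDeriv ℝ i (fun y => g (L y)) x‖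
      ≤ (1 + ‖L x‖) ^ p * (‖iteratedFDeriv ℝ i g (L x)‖ * ‖L‖ ^ i) := by gcongr
    _ = ((1 + ‖L x‖) ^ p * ‖iteratedFDeriv ℝ i g (L x)‖) * ‖L‖ ^ i := by ring
    _ ≤ S * ‖L‖ ^ i := by gcongr; exact hS _

/-- The tensor product `(g ⊗ h)(x', x'') = g(x') h(x'')` of two Schwartz functions. -/
def SchwartzMap.tensor {m k : ℕ} (g : 𝓢(EuclideanSpace ℝ (Fin m), ℂ))
    (h : 𝓢(EuclideanSpace ℝ (Fin k), ℂ)) : 𝓢(EuclideanSpace ℝ (Fin (m + k)), ℂ) where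
  toFun x := g (headCLM m k x) * h (tailCLM m k x)
  smooth' := ((g.smooth ⊤).comp (headCLM m k).contDiff).mul
    ((h.smooth ⊤).comp (tailCLM m k).contDiff)
  decay' p n := by
    choose A hA0 hA using fun i => SchwartzMap.decay_comp_clm g (headCLM m k) p i
    choose B hB0 hB using fun i => SchwartzMap.decay_comp_clm h (tailCLM m k) p i
    refine ⟨∑ i ∈ Finset.range (n + 1), (n.choose i : ℝ) * A i * B (n - i), fun x => ?_⟩
    have h1 := norm_iteratedFDeriv_mul_le (𝕜 := ℝ) (N := ((⊤ : ℕ∞) : WithTop ℕ∞))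
      ((g.smooth ⊤).comp (headCLM m k).contDiff)
      ((h.smooth ⊤).comp (tailCLM m k).contDiff) x (n := n) (mod_cast le_top)
    have hx : ‖x‖ ^ p ≤ (1 + ‖headCLM m k x‖) ^ p * (1 + ‖tailCLM m k x‖) ^ p := by
      rw [← mul_pow]
      refine pow_le_pow_left₀ (norm_nonneg _) ((norm_le_head_add_tail m k x).trans ?_) _
      nlinarith [mul_nonneg (norm_nonneg (headCLM m k x)) (norm_nonneg (tailCLM m k x))]
    refine (mul_le_mul_of_nonneg_left h1 (by positivity)).trans ?_
    rw [Finset.mul_sum]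
    refine Finset.sum_le_sum fun i _ => ?_
    set a := ‖iteratedFDeriv ℝ i ((g : _ → ℂ) ∘ headCLM m k) x‖
    set b := ‖iteratedFDeriv ℝ (n - i) ((h : _ → ℂ) ∘ tailCLM m k) x‖
    have ha : (1 + ‖headCLM m k x‖) ^ p * a ≤ A i := hA i x
    have hb : (1 + ‖tailCLM m k x‖) ^ p * b ≤ B (n - i) := hB (n - i) x
    calc ‖x‖ ^ p * ((n.choose i : ℝ) * a * b)
        ≤ ((1 + ‖headCLM m k x‖) ^ p * (1 + ‖tailCLM m k x‖) ^ p) *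
            ((n.choose i : ℝ) * a * b) := by gcongr
      _ = (n.choose i : ℝ) * (((1 + ‖headCLM m k x‖) ^ p * a) *
            ((1 + ‖tailCLM m k x‖) ^ p * b)) := by ring
      _ ≤ (n.choose i : ℝ) * (A i * B (n - i)) := by
          gcongr
          exact hA0 i
      _ = (n.choose i : ℝ) * A i * B (n - i) := by ring

theorem SchwartzMap.tensor_apply {m k : ℕ} (g : 𝓢(EuclideanSpace ℝ (Fin m), ℂ))
    (h : 𝓢(EuclideanSpace ℝ (Fin k), ℂ)) (x : EuclideanSpace ℝ (Fin (m + k))) :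
    g.tensor h x = g (headCLM m k x) * h (tailCLM m k x) := rfl

theorem decay_exp_quadratic {k : ℕ} (a : Fin k → ℝ) (ha : ∀ j, 0 < a j) (p n : ℕ) :
    ∃ C : ℝ, ∀ x : EuclideanSpace ℝ (Fin k),
      ‖x‖ ^ p * ‖iteratedFDeriv ℝ n (fun y : EuclideanSpace ℝ (Fin k) =>
        Real.exp (-∑ j, a j * y j ^ 2)) x‖ ≤ C := by
  obtain ⟨c, hc, hca⟩ : ∃ c : ℝ, 0 < c ∧ ∀ j, c ≤ a j := by
    rcases isEmpty_or_nonempty (Fin k) with h | h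
    · exact ⟨1, one_pos, fun j => h.elim j⟩
    · obtain ⟨j, hj⟩ := Finite.exists_min a
      exact ⟨a j, ha j, hj⟩
  set Q : EuclideanSpace ℝ (Fin k) → ℝ := fun y => -∑ j, a j * y j ^ 2 with hQ
  have hQt : Q.HasTemperateGrowth := by
    refine Function.HasTemperateGrowth.neg (Function.HasTemperateGrowth.sum fun j _ => ?_)
    exact (Function.HasTemperateGrowth.const (a j)).mul
      ((EuclideanSpace.proj j : EuclideanSpace ℝ (Fin k) →L[ℝ] ℝ).hasTemperateGrowth.pow 2)
  have hQle : ∀ x, Q x ≤ -(c * ‖x‖ ^ 2) := fun x => by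
    rw [hQ, EuclideanSpace.norm_sq_eq, Finset.mul_sum]
    refine neg_le_neg (Finset.sum_le_sum fun j _ => ?_)
    rw [Real.norm_eq_abs, sq_abs]
    exact mul_le_mul_of_nonneg_right (hca j) (sq_nonneg _)
  obtain ⟨l, D, hD0, hD⟩ := hQt.norm_iteratedFDeriv_le_uniform n
  set N : ℝ := ((p + l * n : ℕ) : ℝ) with hN
  refine ⟨n.factorial * (D + 1) ^ n * Real.exp (N ^ 2 / (4 * c)), fun x => ?_⟩
  have h1 : ‖iteratedFDeriv ℝ n (Real.exp ∘ Q) x‖ ≤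
      n.factorial * Real.exp (Q x) * ((D + 1) * (1 + ‖x‖) ^ l) ^ n := by
    refine norm_iteratedFDeriv_comp_le (N := ((⊤ : ℕ∞) : WithTop ℕ∞)) Real.contDiff_exp hQt.1 (mod_cast le_top) x ?_ ?_
    · intro i _
      rw [norm_iteratedFDeriv_eq_norm_iteratedDeriv, iteratedDeriv_eq_iterate,
        Real.iter_deriv_exp, Real.norm_eq_abs, Real.abs_exp]
    · intro i hi hin
      have hE : 1 ≤ (D + 1) * (1 + ‖x‖) ^ l :=
        one_le_mul_of_one_le_of_one_le (by linarith)
          (one_le_pow₀ (by linarith [norm_nonneg x]))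
      refine (hD i hin x).trans (le_trans ?_ (le_self_pow₀ hE (by omega)))
      gcongr
      linarith
  have h2 : (1 + ‖x‖) ^ (p + l * n) * Real.exp (Q x) ≤ Real.exp (N ^ 2 / (4 * c)) := by
    have h3 : (1 + ‖x‖) ^ (p + l * n) ≤ Real.exp (N * ‖x‖) := by
      rw [hN, Real.exp_nat_mul]
      refine pow_le_pow_left₀ (by positivity) ?_ _
      linarith [Real.add_one_le_exp ‖x‖]
    refine (mul_le_mul_of_nonneg_right h3 (Real.exp_pos _).le).trans ?_
    rw [← Real.exp_add]
    refine Real.exp_le_exp.2 ?_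
    have h4 : N * ‖x‖ - c * ‖x‖ ^ 2 ≤ N ^ 2 / (4 * c) := by
      rw [le_div_iff₀ (by positivity)]
      nlinarith [sq_nonneg (N - 2 * c * ‖x‖)]
    linarith [hQle x]
  calc ‖x‖ ^ p * ‖iteratedFDeriv ℝ n (Real.exp ∘ Q) x‖
      ≤ (1 + ‖x‖) ^ p *
          (n.factorial * Real.exp (Q x) * ((D + 1) * (1 + ‖x‖) ^ l) ^ n) := by
        gcongr
        linarith
    _ = n.factorial * (D + 1) ^ n * ((1 + ‖x‖) ^ (p + l * n) * Real.exp (Q x)) := by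
        rw [mul_pow, pow_add, ← pow_mul]; ring
    _ ≤ _ := by gcongr

theorem contDiff_exp_quadratic {k : ℕ} (a : Fin k → ℝ) :
    ContDiff ℝ ((⊤ : ℕ∞) : WithTop ℕ∞) (fun y : EuclideanSpace ℝ (Fin k) => Real.exp (-∑ j, a j * y j ^ 2)) := by
  fun_prop

/-- The function `x ↦ exp(-∑ aⱼ xⱼ²)` with all `aⱼ > 0`. -/
def expQuadratic {k : ℕ} (a : Fin k → ℝ) (ha : ∀ j, 0 < a j) :
    𝓢(EuclideanSpace ℝ (Fin k), ℝ) where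
  toFun := fun x => Real.exp (-∑ j, a j * x j ^ 2)
  smooth' := contDiff_exp_quadratic a
  decay' := fun p n => decay_exp_quadratic a ha p n

/-- The Gaussian window `x ↦ (2πħ)^{-k/2} exp(-⟨x, Qx⟩ / (2ħ))` on `ℝ^k`, where
`Q = diag(q₁, …, q_k)` has positive entries. -/
def gaussianWindow (ħ : ℝ) (hħ : 0 < ħ) {k : ℕ} (q : Fin k → ℝ) (hq : ∀ j, 0 < q j) :
    𝓢(EuclideanSpace ℝ (Fin k), ℂ) :=
  (((2 * Real.pi * ħ) ^ (-(k : ℝ) / 2) : ℝ) : ℂ) •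
    SchwartzMap.postcompCLM Complex.ofRealCLM
      (expQuadratic (fun j => q j / (2 * ħ))
        fun j => div_pos (hq j) (mul_pos two_pos hħ))

theorem gaussianWindow_apply (ħ : ℝ) (hħ : 0 < ħ) {k : ℕ} (q : Fin k → ℝ) (hq : ∀ j, 0 < q j)
    (x : EuclideanSpace ℝ (Fin k)) :
    gaussianWindow ħ hħ q hq x =
      (((2 * Real.pi * ħ) ^ (-(k : ℝ) / 2) *
        Real.exp (-(1 / (2 * ħ)) * ∑ j, x j * (q j * x j)) : ℝ) : ℂ) := by
  have h : -∑ j, q j / (2 * ħ) * x j ^ 2 = -(1 / (2 * ħ)) * ∑ j, x j * (q j * x j) := by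
    rw [neg_mul, Finset.mul_sum]
    congr 1
    exact Finset.sum_congr rfl fun j _ => by ring
  rw [← h, Complex.ofReal_mul]
  rfl

theorem hasTemperateGrowth_character (c : ℝ) {d : ℕ} (ξ : EuclideanSpace ℝ (Fin d)) :
    (fun y : EuclideanSpace ℝ (Fin d) =>
      Complex.exp (((c * inner ℝ ξ y : ℝ) : ℂ) * Complex.I)).HasTemperateGrowth := by
  have hd : ∀ n : ℕ, iteratedDeriv n (fun t : ℝ => Complex.exp ((t : ℂ) * Complex.I)) =
      fun t : ℝ => Complex.I ^ n * Complex.exp ((t : ℂ) * Complex.I) := by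
    intro n
    induction n with
    | zero => simp
    | succ n ih =>
      rw [iteratedDeriv_succ, ih]
      funext t
      have h1 : HasDerivAt (fun t : ℝ => (t : ℂ) * Complex.I) (1 * Complex.I) t :=
        (Complex.ofRealCLM.hasDerivAt (x := t)).mul_const Complex.I
      rw [(h1.cexp.const_mul (Complex.I ^ n)).deriv]
      ring
  have hg : (fun t : ℝ => Complex.exp ((t : ℂ) * Complex.I)).HasTemperateGrowth := by
    refine ⟨(Complex.ofRealCLM.contDiff.mul contDiff_const).cexp, fun n => ⟨0, 1, fun t => ?_⟩⟩
    rw [norm_iteratedFDeriv_eq_norm_iteratedDeriv, hd]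
    simp [Complex.norm_exp_ofReal_mul_I]
  exact hg.comp (c • innerSL ℝ ξ).hasTemperateGrowth

/-- The phase space shift `π(x, ξ) g = M_ξ T_x g`, that is
`y ↦ (2πħ)^{-d/2} e^{i ξ·y / ħ} g(y - x)`. -/
def phaseShift (ħ : ℝ) {d : ℕ} (x ξ : EuclideanSpace ℝ (Fin d))
    (g : 𝓢(EuclideanSpace ℝ (Fin d), ℂ)) : 𝓢(EuclideanSpace ℝ (Fin d), ℂ) :=
  (((2 * Real.pi * ħ) ^ (-(d : ℝ) / 2) : ℝ) : ℂ) •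
    SchwartzMap.smulLeftCLM ℂ
      (fun y => Complex.exp (((ħ⁻¹ * inner ℝ ξ y : ℝ) : ℂ) * Complex.I))
      (SchwartzMap.compSubConstCLM ℂ x g)

theorem phaseShift_apply (ħ : ℝ) {d : ℕ} (x ξ : EuclideanSpace ℝ (Fin d))
    (g : 𝓢(EuclideanSpace ℝ (Fin d), ℂ)) (y : EuclideanSpace ℝ (Fin d)) :
    phaseShift ħ x ξ g y = (((2 * Real.pi * ħ) ^ (-(d : ℝ) / 2) : ℝ) : ℂ) *
      (Complex.exp (((ħ⁻¹ * inner ℝ ξ y : ℝ) : ℂ) * Complex.I) * g (y - x)) := by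
  rw [phaseShift, smul_apply,
    SchwartzMap.smulLeftCLM_apply_apply (hasTemperateGrowth_character ħ⁻¹ ξ)]
  rfl

/-- The complex conjugate of a Schwartz function. -/
def SchwartzMap.conj {d : ℕ} (g : 𝓢(EuclideanSpace ℝ (Fin d), ℂ)) :
    𝓢(EuclideanSpace ℝ (Fin d), ℂ) :=
  SchwartzMap.postcompCLM (Complex.conjCLE : ℂ →L[ℝ] ℂ) g

theorem SchwartzMap.conj_apply {d : ℕ} (g : 𝓢(EuclideanSpace ℝ (Fin d), ℂ))
    (x : EuclideanSpace ℝ (Fin d)) : g.conj x = (starRingEnd ℂ) (g x) := rfl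

/-- The short-time Fourier transform `V_g f(x, ξ) = ⟨f, π(x, ξ) g⟩` of a tempered distribution,
with the convention `⟨f, φ⟩ = f(conj φ)`. -/
def stft (ħ : ℝ) {d : ℕ} (g : 𝓢(EuclideanSpace ℝ (Fin d), ℂ))
    (f : 𝓢'(EuclideanSpace ℝ (Fin d), ℂ)) (x ξ : EuclideanSpace ℝ (Fin d)) : ℂ :=
  f (phaseShift ħ x ξ g).conj

/-- The norm `‖f‖_{M^{∞,1}_{(g)}} = ∫ sup_x |V_g f(x, ξ)| dξ`, with value in `[0, ∞]`. -/
def sjostrandNorm (ħ : ℝ) {d : ℕ} (g : 𝓢(EuclideanSpace ℝ (Fin d), ℂ))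
    (f : 𝓢'(EuclideanSpace ℝ (Fin d), ℂ)) : ℝ≥0∞ :=
  ∫⁻ ξ : EuclideanSpace ℝ (Fin d), ⨆ x : EuclideanSpace ℝ (Fin d), ‖stft ħ g f x ξ‖ₑ

/-- Membership of a tempered distribution in the Sjöstrand class `M^{∞,1}(ℝ^d)`. -/
def MemSjostrand (ħ : ℝ) {d : ℕ} (f : 𝓢'(EuclideanSpace ℝ (Fin d), ℂ)) : Prop :=
  ∃ g : 𝓢(EuclideanSpace ℝ (Fin d), ℂ), g ≠ 0 ∧ sjostrandNorm ħ g f < ⊤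

theorem BoundedContinuousFunction.memLp_top_euclidean {d : ℕ}
    (F : EuclideanSpace ℝ (Fin d) →ᵇ ℂ) : MemLp F ⊤ volume :=
  memLp_top_of_bound F.continuous.aestronglyMeasurable ‖F‖
    (Filter.Eventually.of_forall F.norm_coe_le_norm)

/-- The tempered distribution `φ ↦ ∫ φ(x) F(x) dx` given by a bounded continuous function. -/
def BoundedContinuousFunction.toDistribution {d : ℕ} (F : EuclideanSpace ℝ (Fin d) →ᵇ ℂ) :
    𝓢'(EuclideanSpace ℝ (Fin d), ℂ) :=
  Lp.toTemperedDistribution (F.memLp_top_euclidean.toLp F)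

theorem BoundedContinuousFunction.toDistribution_apply {d : ℕ}
    (F : EuclideanSpace ℝ (Fin d) →ᵇ ℂ) (φ : 𝓢(EuclideanSpace ℝ (Fin d), ℂ)) :
    F.toDistribution φ = ∫ x, φ x * F x := by
  rw [BoundedContinuousFunction.toDistribution, Lp.toTemperedDistribution_apply]
  refine integral_congr_ae ?_
  filter_upwards [F.memLp_top_euclidean.coeFn_toLp] with x hx
  rw [hx, smul_eq_mul]

end

/-! After the substitution `ξ = 2πħη`, the norm becomes a power of `2πħ` times `windowNorm`, the
integral over `η` of the supremum over `x` of `|W_x(η)|`, where `W_x(η) = f(exp(-2πi⟨η, ·⟩) conj g(·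
- x))`.

If this is finite, each `W_x` is integrable. `W_x` is the Fourier transform of the distribution
`conj g(· - x) f`, so that product is the bounded continuous function `𝓕⁻ W_x`. These local pieces
agree after cross multiplication by the windows, and dividing by a nonzero window value glues them
to one function `F` (`exists_toDistribution_eq`). Two facts on tempered distributions carry this:
the interchange `T(φ * h) = ∫ φ(ξ) T(h(· - ξ)) dξ` (`TemperedDistribution.apply_conv`), and the
vanishing of a distribution all of whose localizations by translates of one nonzero window vanish.

Restricting a function to `x'' = 0` amounts to integrating its Fourier transform over the
frequencies `ζ` dual to `x''`. If the window satisfies `G(·, b) = c g`, then `conj c` times the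
transform of `F(·, 0) conj g(· - x)` is `∫ W_{(x,-b)}(η, ζ) dζ`, whence `|c| ‖F(·, 0)‖_g ≤ ‖F‖_G`
(`windowNorm_restrictHead_le`). For `G = g' ⊗ g''` and `b = 0` the factor is `c = g''(0) =
(2πħ)^{-k/2}`, exactly the ratio of the normalizing powers in dimensions `m` and `m + k`, so the
constant is `1`.

Equality holds for `f = 1`: its norm is the `L¹` norm of the Fourier transform of the conjugate
window, which is multiplicative on tensor products and equals `g''(0)` for the Gaussian, whose
transform is nonnegative. -/

noncomputable section

open FourierTransform LineDeriv

/-! ### Tempered distributions applied to convolutions -/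

section Interchange

variable {V : Type*} [NormedAddCommGroup V] [InnerProductSpace ℝ V]

theorem SchwartzMap.iteratedFDeriv_compSubConstCLM (h : 𝓢(V, ℂ)) (a : V) (n : ℕ) (y : V) :
    iteratedFDeriv ℝ n (SchwartzMap.compSubConstCLM ℂ a h) y = iteratedFDeriv ℝ n h (y - a) := by
  have : ⇑(SchwartzMap.compSubConstCLM ℂ a h) = fun x => h (x - a) := by
    ext x; simp
  rw [this, iteratedFDeriv_comp_sub]

theorem SchwartzMap.seminorm_compSubConstCLM_le (h : 𝓢(V, ℂ)) (k n : ℕ) :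
    ∃ C : ℝ, 0 ≤ C ∧ ∀ a : V,
      SchwartzMap.seminorm ℂ k n (SchwartzMap.compSubConstCLM ℂ a h) ≤ C * (1 + ‖a‖) ^ k := by
  set S := (2 : ℝ) ^ k * (Finset.Iic (k, n)).sup (fun m => SchwartzMap.seminorm ℂ m.1 m.2) h
  have hS : ∀ y, (1 + ‖y‖) ^ k * ‖iteratedFDeriv ℝ n h y‖ ≤ S := fun y =>
    SchwartzMap.one_add_le_sup_seminorm_apply (𝕜 := ℂ) (m := (k, n)) le_rfl le_rfl h y
  have hS0 : 0 ≤ S := le_trans (by positivity) (hS 0)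
  refine ⟨S, hS0, fun a => SchwartzMap.seminorm_le_bound ℂ k n _ (by positivity) fun y => ?_⟩
  rw [SchwartzMap.iteratedFDeriv_compSubConstCLM]
  have hy : ‖y‖ ≤ (1 + ‖y - a‖) * (1 + ‖a‖) := by
    have := norm_le_norm_sub_add y a
    nlinarith [norm_nonneg (y - a), norm_nonneg a, mul_nonneg (norm_nonneg (y - a)) (norm_nonneg a)]
  calc ‖y‖ ^ k * ‖iteratedFDeriv ℝ n h (y - a)‖
      ≤ ((1 + ‖y - a‖) * (1 + ‖a‖)) ^ k * ‖iteratedFDeriv ℝ n h (y - a)‖ := by gcongr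
    _ = ((1 + ‖y - a‖) ^ k * ‖iteratedFDeriv ℝ n h (y - a)‖) * (1 + ‖a‖) ^ k := by
        rw [mul_pow]; ring
    _ ≤ S * (1 + ‖a‖) ^ k := by gcongr; exact hS _

theorem SchwartzMap.seminorm_compSubConstCLM_sub_le (h : 𝓢(V, ℂ)) (k n : ℕ) :
    ∃ C : ℝ, 0 ≤ C ∧ ∀ a b : V,
      SchwartzMap.seminorm ℂ k n
        (SchwartzMap.compSubConstCLM ℂ a h - SchwartzMap.compSubConstCLM ℂ b h) ≤
          C * (1 + ‖a‖ + ‖b‖) ^ k * ‖a - b‖ := by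
  set S := (2 : ℝ) ^ k * (Finset.Iic (k, n + 1)).sup (fun m => SchwartzMap.seminorm ℂ m.1 m.2) h
  have hS : ∀ y, (1 + ‖y‖) ^ k * ‖iteratedFDeriv ℝ (n + 1) h y‖ ≤ S := fun y =>
    SchwartzMap.one_add_le_sup_seminorm_apply (𝕜 := ℂ) (m := (k, n + 1)) le_rfl le_rfl h y
  have hS0 : 0 ≤ S := le_trans (by positivity) (hS 0)
  refine ⟨S, hS0, fun a b => SchwartzMap.seminorm_le_bound ℂ k n _ (by positivity) fun y => ?_⟩
  have h1 : iteratedFDeriv ℝ n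
      (SchwartzMap.compSubConstCLM ℂ a h - SchwartzMap.compSubConstCLM ℂ b h : 𝓢(V, ℂ)) y =
      iteratedFDeriv ℝ n h (y - a) - iteratedFDeriv ℝ n h (y - b) := by
    rw [← SchwartzMap.iteratedFDeriv_compSubConstCLM, ← SchwartzMap.iteratedFDeriv_compSubConstCLM]
    have : ⇑(SchwartzMap.compSubConstCLM ℂ a h - SchwartzMap.compSubConstCLM ℂ b h : 𝓢(V, ℂ)) =
        ⇑(SchwartzMap.compSubConstCLM ℂ a h) - ⇑(SchwartzMap.compSubConstCLM ℂ b h) := by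
      ext; simp
    rw [this]
    exact iteratedFDeriv_sub_apply ((SchwartzMap.smooth _ n).contDiffAt)
      ((SchwartzMap.smooth _ n).contDiffAt)
  rw [h1]
  -- The mean value bound below divides by `‖y‖ ^ k`; when this weight is zero the estimate is
  -- trivial.
  rcases (pow_nonneg (norm_nonneg y) k).eq_or_lt with hy | hy
  · rw [← hy, zero_mul]
    positivity
  have h2 : ‖iteratedFDeriv ℝ n h (y - a) - iteratedFDeriv ℝ n h (y - b)‖ ≤
      (S * (1 + ‖a‖ + ‖b‖) ^ k / ‖y‖ ^ k) * ‖(y - a) - (y - b)‖ := by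
    refine (convex_segment (y - b) (y - a)).norm_image_sub_le_of_norm_fderiv_le (𝕜 := ℝ)
      (fun z _ => ?_) (fun z hz => ?_) (left_mem_segment ℝ _ _) (right_mem_segment ℝ _ _)
    · exact ((h.smooth ⊤).differentiable_iteratedFDeriv (m := n)
        (by exact_mod_cast WithTop.coe_lt_top n)).differentiableAt
    · rw [norm_fderiv_iteratedFDeriv, le_div_iff₀ hy]
      have hz' : ‖y‖ ≤ (1 + ‖z‖) * (1 + ‖a‖ + ‖b‖) := by
        obtain ⟨s, t, hs, ht, hst, rfl⟩ := hz
        -- A point `z` of the segment differs from `y` by a convex combination of `a` and `b`, so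
        -- the weight at `y` is controlled by the weight at `z`.
        have e : y = (s • (y - b) + t • (y - a)) + (s • b + t • a) := by
          rw [add_add_add_comm, ← smul_add, ← smul_add, sub_add_cancel, sub_add_cancel, ← add_smul,
            hst, one_smul]
        have e2 : ‖s • b + t • a‖ ≤ ‖a‖ + ‖b‖ := by
          refine (norm_add_le _ _).trans ?_
          rw [norm_smul, norm_smul, Real.norm_of_nonneg hs, Real.norm_of_nonneg ht]
          nlinarith [norm_nonneg a, norm_nonneg b]
        have e3 := norm_add_le (s • (y - b) + t • (y - a)) (s • b + t • a)
        rw [← e] at e3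
        nlinarith [norm_nonneg a, norm_nonneg b, norm_nonneg (s • (y - b) + t • (y - a)),
          mul_nonneg (norm_nonneg (s • (y - b) + t • (y - a))) (add_nonneg (norm_nonneg a) (norm_nonneg b))]
      calc ‖iteratedFDeriv ℝ (n + 1) h z‖ * ‖y‖ ^ k
          ≤ ‖iteratedFDeriv ℝ (n + 1) h z‖ * ((1 + ‖z‖) * (1 + ‖a‖ + ‖b‖)) ^ k := by gcongr
        _ = ((1 + ‖z‖) ^ k * ‖iteratedFDeriv ℝ (n + 1) h z‖) * (1 + ‖a‖ + ‖b‖) ^ k := by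
            rw [mul_pow]; ring
        _ ≤ S * (1 + ‖a‖ + ‖b‖) ^ k := by gcongr; exact hS _
  calc _ ≤ ‖y‖ ^ k * ((S * (1 + ‖a‖ + ‖b‖) ^ k / ‖y‖ ^ k) * ‖(y - a) - (y - b)‖) := by gcongr
    _ = _ := by
      rw [sub_sub_sub_cancel_left, norm_sub_rev b a]
      field_simp

theorem SchwartzMap.continuous_compSubConstCLM (h : 𝓢(V, ℂ)) :
    Continuous fun a : V => SchwartzMap.compSubConstCLM ℂ a h := by
  rw [continuous_iff_continuousAt]
  intro b
  rw [ContinuousAt, (schwartz_withSeminorms ℂ V ℂ).tendsto_nhds]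
  rintro ⟨k, n⟩ ε hε
  obtain ⟨C, hC, hb⟩ := SchwartzMap.seminorm_compSubConstCLM_sub_le h k n
  have hc : Continuous fun a : V => C * (1 + ‖a‖ + ‖b‖) ^ k * ‖a - b‖ := by fun_prop
  have := hc.tendsto b
  simp only [sub_self, norm_zero, mul_zero] at this
  filter_upwards [this.eventually_lt_const hε] with a ha
  exact (hb a b).trans_lt ha

/-- A point together with a tuple of directions of norm at most one. -/
abbrev PointedDirections (V : Type*) [NormedAddCommGroup V] (n : ℕ) : Type _ :=
  V × (Fin n → Metric.closedBall (0 : V) 1)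

theorem SchwartzMap.norm_pow_mul_iteratedFDeriv_apply_le (k n : ℕ) (ψ : 𝓢(V, ℂ))
    (p : PointedDirections V n) :
    ‖((‖p.1‖ ^ k : ℝ) : ℂ) * iteratedFDeriv ℝ n ψ p.1 (fun i => p.2 i)‖ ≤
      SchwartzMap.seminorm ℂ k n ψ := by
  rw [norm_mul, Complex.norm_real, norm_pow, norm_norm]
  refine le_trans ?_ (SchwartzMap.le_seminorm ℂ k n ψ p.1)
  gcongr
  refine (ContinuousMultilinearMap.le_opNorm _ _).trans
    (mul_le_of_le_one_right (norm_nonneg _) (Finset.prod_le_one (fun _ _ => norm_nonneg _) ?_))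
  exact fun i _ => mem_closedBall_zero_iff.1 (p.2 i).2

/-- The map `ψ ↦ ((y, v) ↦ ‖y‖ ^ k * D^n ψ(y) v)` from Schwartz functions to bounded continuous
functions. -/
def SchwartzMap.weightedDeriv (k n : ℕ) : 𝓢(V, ℂ) →ₗ[ℂ] (PointedDirections V n →ᵇ ℂ) where
  toFun ψ := BoundedContinuousFunction.ofNormedAddCommGroup
    (fun p : PointedDirections V n =>
      ((‖p.1‖ ^ k : ℝ) : ℂ) * iteratedFDeriv ℝ n ψ p.1 (fun i => p.2 i))
    (by
      have h : Continuous (iteratedFDeriv ℝ n ψ) :=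
        (ψ.smooth ⊤).continuous_iteratedFDeriv (by exact_mod_cast le_top)
      fun_prop)
    (SchwartzMap.seminorm ℂ k n ψ) (SchwartzMap.norm_pow_mul_iteratedFDeriv_apply_le k n ψ)
  map_add' ψ φ := by
    ext1 p
    have h : iteratedFDeriv ℝ n (⇑(ψ + φ)) p.1 =
        iteratedFDeriv ℝ n ψ p.1 + iteratedFDeriv ℝ n φ p.1 := by
      have : ⇑(ψ + φ) = ⇑ψ + ⇑φ := by ext; simp
      rw [this]
      exact iteratedFDeriv_add_apply (ψ.smooth n).contDiffAt (φ.smooth n).contDiffAt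
    change ((‖p.1‖ ^ k : ℝ) : ℂ) * iteratedFDeriv ℝ n (⇑(ψ + φ)) p.1 (fun i => p.2 i) = _
    rw [h, add_apply, mul_add]
    rfl
  map_smul' c ψ := by
    ext1 p
    have h : iteratedFDeriv ℝ n (⇑(c • ψ)) p.1 = c • iteratedFDeriv ℝ n ψ p.1 := by
      have : ⇑(c • ψ) = c • ⇑ψ := by ext; simp
      rw [this]
      exact iteratedFDeriv_const_smul_apply (ψ.smooth n).contDiffAt
    change ((‖p.1‖ ^ k : ℝ) : ℂ) * iteratedFDeriv ℝ n (⇑(c • ψ)) p.1 (fun i => p.2 i) =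
      c * (((‖p.1‖ ^ k : ℝ) : ℂ) * iteratedFDeriv ℝ n ψ p.1 (fun i => p.2 i))
    rw [h, smul_apply, smul_eq_mul, mul_left_comm]

theorem SchwartzMap.weightedDeriv_apply (k n : ℕ) (ψ : 𝓢(V, ℂ)) (p : PointedDirections V n) :
    SchwartzMap.weightedDeriv k n ψ p =
      ((‖p.1‖ ^ k : ℝ) : ℂ) * iteratedFDeriv ℝ n ψ p.1 (fun i => p.2 i) := rfl

theorem SchwartzMap.norm_weightedDeriv_le (k n : ℕ) (ψ : 𝓢(V, ℂ)) :
    ‖SchwartzMap.weightedDeriv k n ψ‖ ≤ SchwartzMap.seminorm ℂ k n ψ :=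
  BoundedContinuousFunction.norm_ofNormedAddCommGroup_le _ (apply_nonneg _ _)
    (SchwartzMap.norm_pow_mul_iteratedFDeriv_apply_le k n ψ)

theorem ContinuousMultilinearMap.opNorm_le_of_closedBall {n : ℕ} (A : V [×n]→L[ℝ] ℂ) {M : ℝ}
    (hM : 0 ≤ M) (h : ∀ v : Fin n → Metric.closedBall (0 : V) 1, ‖A fun i => v i‖ ≤ M) :
    ‖A‖ ≤ M := by
  refine ContinuousMultilinearMap.opNorm_le_bound hM fun v => ?_
  have hv : ∀ i, ‖v i‖⁻¹ • v i ∈ Metric.closedBall (0 : V) 1 := fun i => by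
    rw [mem_closedBall_zero_iff, norm_smul, norm_inv, norm_norm]
    exact inv_mul_le_one
  have h1 : v = fun i => ‖v i‖ • (‖v i‖⁻¹ • v i) := by
    ext1 i
    rcases eq_or_ne (v i) 0 with h0 | h0
    · simp [h0]
    · rw [smul_smul, mul_inv_cancel₀ (norm_ne_zero_iff.2 h0), one_smul]
  have h2 : ‖A v‖ = (∏ i, ‖v i‖) * ‖A fun i => ‖v i‖⁻¹ • v i‖ := by
    conv_lhs => rw [h1]
    rw [ContinuousMultilinearMap.map_smul_univ, norm_smul,
      Real.norm_of_nonneg (Finset.prod_nonneg fun _ _ => norm_nonneg _)]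
  rw [h2, mul_comm]
  gcongr
  exact h fun i => ⟨_, hv i⟩

/-- Together with `SchwartzMap.norm_weightedDeriv_le` this realizes each Schwartz seminorm as a
Banach space norm, so that Hahn–Banach and the Bochner integral become available. -/
theorem SchwartzMap.seminorm_le_norm_weightedDeriv (k n : ℕ) (ψ : 𝓢(V, ℂ)) :
    SchwartzMap.seminorm ℂ k n ψ ≤ ‖SchwartzMap.weightedDeriv k n ψ‖ := by
  refine SchwartzMap.seminorm_le_bound ℂ k n _ (norm_nonneg _) fun y => ?_
  have h : ‖(‖y‖ ^ k) • iteratedFDeriv ℝ n ψ y‖ ≤ ‖SchwartzMap.weightedDeriv k n ψ‖ := by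
    refine ContinuousMultilinearMap.opNorm_le_of_closedBall _ (norm_nonneg _) fun v => ?_
    have := (SchwartzMap.weightedDeriv k n ψ).norm_coe_le_norm (y, v)
    rwa [SchwartzMap.weightedDeriv_apply, ← Complex.real_smul] at this
  rwa [norm_smul, norm_pow, norm_norm] at h

theorem SchwartzMap.continuous_weightedDeriv (k n : ℕ) :
    Continuous (SchwartzMap.weightedDeriv (V := V) k n) := by
  refine (schwartz_withSeminorms ℂ V ℂ).continuous_normedSpace_rng _ _ ⟨{(k, n)}, 1, fun ψ => ?_⟩
  simpa using SchwartzMap.norm_weightedDeriv_le k n ψ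

/-- Every tempered distribution factors through finitely many weighted derivatives. -/
theorem TemperedDistribution.exists_factor_weightedDeriv (T : 𝓢'(V, ℂ)) :
    ∃ (s : Finset (ℕ × ℕ)) (Λ : (∀ i : s, PointedDirections V i.1.2 →ᵇ ℂ) →L[ℂ] ℂ),
      ∀ ψ : 𝓢(V, ℂ), T ψ = Λ fun i => SchwartzMap.weightedDeriv i.1.1 i.1.2 ψ := by
  have hT : Continuous fun ψ : 𝓢(V, ℂ) => T ψ := T.continuous
  obtain ⟨s, C, -, hC⟩ := Seminorm.bound_of_continuous (schwartz_withSeminorms ℂ V ℂ)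
    ((normSeminorm ℂ ℂ).comp (T : 𝓢(V, ℂ) →ₗ[ℂ] ℂ)) hT.norm
  let J : 𝓢(V, ℂ) →ₗ[ℂ] (∀ i : s, PointedDirections V i.1.2 →ᵇ ℂ) :=
    LinearMap.pi fun i => SchwartzMap.weightedDeriv i.1.1 i.1.2
  have hb : ∀ ψ, ‖T ψ‖ ≤ C * ‖J ψ‖ := fun ψ => by
    have h1 : ‖T ψ‖ ≤ C * (s.sup (schwartzSeminormFamily ℂ V ℂ)) ψ := hC ψ
    refine h1.trans (mul_le_mul_of_nonneg_left ?_ C.2)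
    refine Seminorm.finset_sup_apply_le (norm_nonneg _) fun i hi => ?_
    exact (SchwartzMap.seminorm_le_norm_weightedDeriv i.1 i.2 ψ).trans
      (norm_le_pi_norm (J ψ) ⟨i, hi⟩)
  have hker : LinearMap.ker J ≤ LinearMap.ker (T : 𝓢(V, ℂ) →ₗ[ℂ] ℂ) := fun ψ hψ => by
    have h0 : J ψ = 0 := hψ
    have h1 : ‖T ψ‖ ≤ 0 := by simpa [h0] using hb ψ
    exact norm_le_zero_iff.1 h1
  -- Since `‖T ψ‖ ≤ C ‖J ψ‖`, the value `T ψ` depends on `J ψ` only and is a bounded functional of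
  -- it; Hahn–Banach extends this functional from the range of `J` to the whole product.
  let L : LinearMap.range J →ₗ[ℂ] ℂ :=
    ((LinearMap.ker J).liftQ (T : 𝓢(V, ℂ) →ₗ[ℂ] ℂ) hker).comp
      J.quotKerEquivRange.symm.toLinearMap
  have hL : ∀ ψ, L ⟨J ψ, LinearMap.mem_range_self J ψ⟩ = T ψ := fun ψ => by
    have : J.quotKerEquivRange.symm ⟨J ψ, LinearMap.mem_range_self J ψ⟩ =
        (LinearMap.ker J).mkQ ψ := by
      rw [LinearEquiv.symm_apply_eq]
      rfl
    simp only [L, LinearMap.comp_apply, LinearEquiv.coe_coe, this]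
    rfl
  let L' : StrongDual ℂ (LinearMap.range J) := L.mkContinuous C (by
    rintro ⟨_, ψ, rfl⟩
    rw [hL]
    exact hb ψ)
  obtain ⟨Λ, hΛ, -⟩ := exists_extension_norm_eq _ L'
  exact ⟨s, Λ, fun ψ => by rw [← hL ψ]; exact (hΛ ⟨J ψ, LinearMap.mem_range_self J ψ⟩).symm⟩

variable [FiniteDimensional ℝ V] [MeasurableSpace V] [BorelSpace V]

/-- The convolution of two complex-valued Schwartz functions. -/
abbrev SchwartzMap.conv (φ h : 𝓢(V, ℂ)) : 𝓢(V, ℂ) :=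
  SchwartzMap.convolution (ContinuousLinearMap.mul ℂ ℂ) φ h

theorem SchwartzMap.conv_apply (φ h : 𝓢(V, ℂ)) (y : V) :
    φ.conv h y = ∫ t, φ t * h (y - t) := by
  rw [SchwartzMap.conv, SchwartzMap.convolution_apply, MeasureTheory.convolution_def]
  rfl

/-- On the Fourier side convolution is a product and the derivative a scalar multiplier, which may
be attached to either factor. -/
theorem SchwartzMap.lineDerivOp_conv (φ h : 𝓢(V, ℂ)) (v : V) :
    ∂_{v} (φ.conv h) = φ.conv (∂_{v} h) := by
  have hinj : Function.Injective (𝓕 : 𝓢(V, ℂ) → 𝓢(V, ℂ)) := fun a b hab => by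
    simpa using congrArg (𝓕⁻ : 𝓢(V, ℂ) → 𝓢(V, ℂ)) hab
  apply hinj
  have hg : Function.HasTemperateGrowth fun x : V => inner ℝ x v := by fun_prop
  ext x
  simp only [SchwartzMap.conv, SchwartzMap.fourier_lineDerivOp_eq, SchwartzMap.fourier_convolution]
  simp [SchwartzMap.smulLeftCLM_apply_apply hg, SchwartzMap.pairing_apply_apply]
  ring

theorem SchwartzMap.iteratedLineDerivOp_conv (φ h : 𝓢(V, ℂ)) {n : ℕ} (v : Fin n → V) :
    ∂^{v} (φ.conv h) = φ.conv (∂^{v} h) := by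
  induction n with
  | zero => simp
  | succ n ih =>
    rw [iteratedLineDerivOp_succ_left, iteratedLineDerivOp_succ_left, ih,
      SchwartzMap.lineDerivOp_conv]

theorem SchwartzMap.integrable_one_add_norm_pow_mul (φ : 𝓢(V, ℂ)) (N : ℕ) :
    Integrable fun x => (1 + ‖x‖) ^ N * ‖φ x‖ := by
  have h : Integrable fun x => (2 : ℝ) ^ N * (‖φ x‖ + ‖x‖ ^ N * ‖φ x‖) :=
    (φ.integrable.norm.add (SchwartzMap.integrable_pow_mul volume φ N)).const_mul _
  refine h.mono' (by fun_prop) (Filter.Eventually.of_forall fun x => ?_)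
  rw [Real.norm_of_nonneg (by positivity)]
  have h1 : (1 + ‖x‖) ^ N ≤ 2 ^ N * (1 + ‖x‖ ^ N) := by
    rcases le_total ‖x‖ 1 with hx | hx
    · calc (1 + ‖x‖) ^ N ≤ 2 ^ N := by gcongr; linarith
        _ ≤ 2 ^ N * (1 + ‖x‖ ^ N) :=
          le_mul_of_one_le_right (by positivity) (by linarith [pow_nonneg (norm_nonneg x) N])
    · calc (1 + ‖x‖) ^ N ≤ (2 * ‖x‖) ^ N := by gcongr; linarith
        _ ≤ 2 ^ N * (1 + ‖x‖ ^ N) := by rw [mul_pow]; gcongr; linarith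
  calc _ ≤ (2 ^ N * (1 + ‖x‖ ^ N)) * ‖φ x‖ := by gcongr
    _ = _ := by ring

theorem SchwartzMap.integrable_smul_weightedDeriv_translate (φ h : 𝓢(V, ℂ)) (k n : ℕ) :
    Integrable fun ξ => φ ξ •
      SchwartzMap.weightedDeriv k n (SchwartzMap.compSubConstCLM ℂ ξ h) := by
  obtain ⟨C, hC, hb⟩ := SchwartzMap.seminorm_compSubConstCLM_le h k n
  have hc : Continuous fun ξ : V => φ ξ •
      SchwartzMap.weightedDeriv k n (SchwartzMap.compSubConstCLM ℂ ξ h) :=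
    φ.continuous.smul ((SchwartzMap.continuous_weightedDeriv k n).comp h.continuous_compSubConstCLM)
  refine ((SchwartzMap.integrable_one_add_norm_pow_mul φ k).const_mul C).mono'
    hc.aestronglyMeasurable (Filter.Eventually.of_forall fun ξ => ?_)
  rw [norm_smul]
  calc _ ≤ ‖φ ξ‖ * (C * (1 + ‖ξ‖) ^ k) := by
        gcongr
        exact (SchwartzMap.norm_weightedDeriv_le _ _ _).trans (hb ξ)
    _ = _ := by ring

theorem SchwartzMap.integral_smul_weightedDeriv_translate (φ h : 𝓢(V, ℂ)) (k n : ℕ) :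
    ∫ ξ, φ ξ • SchwartzMap.weightedDeriv k n (SchwartzMap.compSubConstCLM ℂ ξ h) =
      SchwartzMap.weightedDeriv k n (φ.conv h) := by
  have hint := SchwartzMap.integrable_smul_weightedDeriv_translate φ h k n
  ext1 p
  have hev : ∀ F : PointedDirections V n →ᵇ ℂ, BoundedContinuousFunction.evalCLM ℂ p F = F p :=
    fun _ => rfl
  rw [← hev, ← ContinuousLinearMap.integral_comp_comm _ hint, SchwartzMap.weightedDeriv_apply,
    ← SchwartzMap.iteratedLineDerivOp_eq_iteratedFDeriv, SchwartzMap.iteratedLineDerivOp_conv,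
    SchwartzMap.conv_apply, ← integral_const_mul]
  refine integral_congr_ae (Filter.Eventually.of_forall fun ξ => ?_)
  change φ ξ * SchwartzMap.weightedDeriv k n (SchwartzMap.compSubConstCLM ℂ ξ h) p = _
  rw [SchwartzMap.weightedDeriv_apply, SchwartzMap.iteratedFDeriv_compSubConstCLM,
    ← SchwartzMap.iteratedLineDerivOp_eq_iteratedFDeriv, mul_left_comm]

/-- `φ * h` is the superposition of the translates of `h` with weight `φ`. In the weighted
derivatives through which `T` factors, this superposition is a Bochner integral in a Banach space,
and a continuous functional commutes with it. -/
theorem TemperedDistribution.apply_conv (T : 𝓢'(V, ℂ)) (φ h : 𝓢(V, ℂ)) :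
    T (φ.conv h) = ∫ ξ, φ ξ * T (SchwartzMap.compSubConstCLM ℂ ξ h) := by
  obtain ⟨s, Λ, hΛ⟩ := TemperedDistribution.exists_factor_weightedDeriv T
  have hint : Integrable fun ξ => fun i : s => φ ξ •
      SchwartzMap.weightedDeriv i.1.1 i.1.2 (SchwartzMap.compSubConstCLM ℂ ξ h) :=
    Integrable.of_eval fun i => SchwartzMap.integrable_smul_weightedDeriv_translate φ h _ _
  have h1 : ∫ ξ, (fun i : s => φ ξ •
      SchwartzMap.weightedDeriv i.1.1 i.1.2 (SchwartzMap.compSubConstCLM ℂ ξ h)) =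
      fun i : s => SchwartzMap.weightedDeriv i.1.1 i.1.2 (φ.conv h) := by
    ext1 i
    rw [eval_integral fun i => SchwartzMap.integrable_smul_weightedDeriv_translate φ h _ _]
    exact SchwartzMap.integral_smul_weightedDeriv_translate φ h _ _
  rw [hΛ, ← h1, ← Λ.integral_comp_comm hint]
  refine integral_congr_ae (Filter.Eventually.of_forall fun ξ => ?_)
  change Λ (φ ξ • fun i : s =>
    SchwartzMap.weightedDeriv i.1.1 i.1.2 (SchwartzMap.compSubConstCLM ℂ ξ h)) = _
  rw [map_smul, smul_eq_mul, ← hΛ]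

end Interchange

/-! ### Schwartz functions separate locally integrable functions -/

section TestFunctions

variable {V : Type*} [NormedAddCommGroup V] [NormedSpace ℝ V] [FiniteDimensional ℝ V]
  [MeasurableSpace V] [BorelSpace V]

theorem ae_eq_of_integral_schwartz_mul_eq {μ : Measure V} {u v : V → ℂ}
    (hu : LocallyIntegrable u μ) (hv : LocallyIntegrable v μ)
    (h : ∀ φ : 𝓢(V, ℂ), ∫ x, φ x * u x ∂μ = ∫ x, φ x * v x ∂μ) : u =ᵐ[μ] v := by
  refine ae_eq_of_integral_contDiff_smul_eq hu hv fun φ hφ hc => ?_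
  have hc' : HasCompactSupport (Complex.ofRealCLM ∘ φ) := hc.comp_left rfl
  have hφ' : ContDiff ℝ ((⊤ : ℕ∞) : WithTop ℕ∞) (Complex.ofRealCLM ∘ φ) :=
    Complex.ofRealCLM.contDiff.comp hφ
  simpa using h (hc'.toSchwartzMap hφ')

theorem eq_of_integral_schwartz_mul_eq {μ : Measure V} [μ.IsOpenPosMeasure]
    [IsLocallyFiniteMeasure μ] {u v : V → ℂ} (hu : Continuous u) (hv : Continuous v)
    (h : ∀ φ : 𝓢(V, ℂ), ∫ x, φ x * u x ∂μ = ∫ x, φ x * v x ∂μ) : u = v :=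
  (hu.ae_eq_iff_eq μ hv).1
    (ae_eq_of_integral_schwartz_mul_eq hu.locallyIntegrable hv.locallyIntegrable h)

end TestFunctions

/-! ### Modulation and localization of tempered distributions -/

section Modulation

variable {d : ℕ}

/-- Multiplication by the character `y ↦ exp(-2πi⟨η, y⟩)` on Schwartz functions. -/
def SchwartzMap.modulate (η : EuclideanSpace ℝ (Fin d)) :
    𝓢(EuclideanSpace ℝ (Fin d), ℂ) →L[ℂ] 𝓢(EuclideanSpace ℝ (Fin d), ℂ) :=
  SchwartzMap.smulLeftCLM ℂ fun y =>
    Complex.exp (((-(2 * Real.pi) * inner ℝ η y : ℝ) : ℂ) * Complex.I)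

theorem SchwartzMap.modulate_apply (η : EuclideanSpace ℝ (Fin d))
    (h : 𝓢(EuclideanSpace ℝ (Fin d), ℂ)) (y : EuclideanSpace ℝ (Fin d)) :
    SchwartzMap.modulate η h y =
      Complex.exp (((-(2 * Real.pi) * inner ℝ η y : ℝ) : ℂ) * Complex.I) * h y := by
  rw [SchwartzMap.modulate, SchwartzMap.smulLeftCLM_apply_apply
    (hasTemperateGrowth_character (-(2 * Real.pi)) η), smul_eq_mul]

theorem SchwartzMap.modulate_zero (h : 𝓢(EuclideanSpace ℝ (Fin d), ℂ)) :
    SchwartzMap.modulate 0 h = h := by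
  ext y
  simp [SchwartzMap.modulate_apply]

theorem SchwartzMap.fourier_compSubConstCLM (h : 𝓢(EuclideanSpace ℝ (Fin d), ℂ))
    (ξ : EuclideanSpace ℝ (Fin d)) :
    𝓕 (SchwartzMap.compSubConstCLM ℂ ξ h) = SchwartzMap.modulate ξ (𝓕 h) := by
  ext y
  have h1 : ⇑(SchwartzMap.compSubConstCLM ℂ ξ h) = ⇑h ∘ fun v => v + -ξ := by
    ext v
    simp [sub_eq_add_neg]
  rw [SchwartzMap.modulate_apply, SchwartzMap.fourier_coe, SchwartzMap.fourier_coe, h1]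
  refine (congrFun (VectorFourier.fourierIntegral_comp_add_right Real.fourierChar volume
    (innerₗ (EuclideanSpace ℝ (Fin d))) (⇑h) (-ξ)) y).trans ?_
  rw [Circle.smul_def, Real.fourierChar_apply, smul_eq_mul]
  congr 4
  simp

/-- The product of two Schwartz functions. -/
abbrev SchwartzMap.mulS (a b : 𝓢(EuclideanSpace ℝ (Fin d), ℂ)) :
    𝓢(EuclideanSpace ℝ (Fin d), ℂ) :=
  SchwartzMap.smulLeftCLM ℂ a b

theorem SchwartzMap.mulS_apply (a b : 𝓢(EuclideanSpace ℝ (Fin d), ℂ))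
    (y : EuclideanSpace ℝ (Fin d)) : a.mulS b y = a y * b y := by
  rw [SchwartzMap.mulS, SchwartzMap.smulLeftCLM_apply_apply a.hasTemperateGrowth, smul_eq_mul]

/-- The Fourier transform turns modulations into translations, which act continuously on a Schwartz
function. -/
theorem TemperedDistribution.continuous_apply_modulate
    (f : 𝓢'(EuclideanSpace ℝ (Fin d), ℂ)) (G : 𝓢(EuclideanSpace ℝ (Fin d), ℂ)) :
    Continuous fun η => f (SchwartzMap.modulate η G) := by
  have h : ∀ η, f (SchwartzMap.modulate η G) =
      𝓕 f (SchwartzMap.compSubConstCLM ℂ η (𝓕⁻ G)) := fun η => by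
    rw [TemperedDistribution.fourier_apply, SchwartzMap.fourier_compSubConstCLM,
      FourierTransform.fourier_fourierInv_eq]
  simp_rw [h]
  exact (𝓕 f).continuous.comp (SchwartzMap.continuous_compSubConstCLM _)

/-- The Fourier transform of `G • f` is the function `η ↦ f(exp(-2πi⟨η, ·⟩) G)`. -/
theorem TemperedDistribution.apply_mulS_fourier (f : 𝓢'(EuclideanSpace ℝ (Fin d), ℂ))
    (G φ : 𝓢(EuclideanSpace ℝ (Fin d), ℂ)) :
    f (G.mulS (𝓕 φ)) = ∫ η, φ η * f (SchwartzMap.modulate η G) := by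
  have h1 : G.mulS (𝓕 φ) = 𝓕 (φ.conv (𝓕⁻ G)) := by
    ext y
    rw [SchwartzMap.conv, SchwartzMap.fourier_convolution, SchwartzMap.pairing_apply_apply,
      FourierTransform.fourier_fourierInv_eq, SchwartzMap.mulS_apply, mul_comm]
    rfl
  rw [h1, ← TemperedDistribution.fourier_apply, TemperedDistribution.apply_conv]
  refine integral_congr_ae (Filter.Eventually.of_forall fun η => ?_)
  simp only [TemperedDistribution.fourier_apply, SchwartzMap.fourier_compSubConstCLM,
    FourierTransform.fourier_fourierInv_eq]

/-- With `h = |g|²`, the distribution `ψ T` annihilates every translate of `h`, hence every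
convolution with `h`. In frequency this says that `𝓕 h(-η) T(exp(-2πi⟨η, ·⟩) ψ)` vanishes for all
`η`. At `η = 0` the first factor is `∫ |g|² > 0`, so `T ψ = 0`. -/
theorem TemperedDistribution.eq_zero_of_apply_mulS_translate_eq_zero
    (T : 𝓢'(EuclideanSpace ℝ (Fin d), ℂ)) (g : 𝓢(EuclideanSpace ℝ (Fin d), ℂ)) (hg : g ≠ 0)
    (hT : ∀ x ψ, T ((SchwartzMap.compSubConstCLM ℂ x g).conj.mulS ψ) = 0) : T = 0 := by
  ext ψ
  rw [zero_apply]
  set h : 𝓢(EuclideanSpace ℝ (Fin d), ℂ) := g.conj.mulS g with hh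
  set S : 𝓢'(EuclideanSpace ℝ (Fin d), ℂ) := TemperedDistribution.smulLeftCLM ℂ ψ T with hS
  have hS0 : ∀ x, S (SchwartzMap.compSubConstCLM ℂ x h) = 0 := fun x => by
    rw [hS, TemperedDistribution.smulLeftCLM_apply_apply,
      ← hT x ((SchwartzMap.compSubConstCLM ℂ x g).mulS ψ)]
    congr 1
    ext y
    change ψ.mulS _ y = _
    simp only [SchwartzMap.mulS_apply, SchwartzMap.compSubConstCLM_apply, hh,
      SchwartzMap.conj_apply]
    ring
  have h0 : (fun η => 𝓕 h (-η) * T (SchwartzMap.modulate η ψ)) = fun _ => 0 := by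
    refine eq_of_integral_schwartz_mul_eq (μ := volume) ?_ continuous_const fun ρ => ?_
    · exact ((𝓕 h).continuous.comp continuous_neg).mul (T.continuous_apply_modulate ψ)
    · let N : 𝓢(EuclideanSpace ℝ (Fin d), ℂ) →L[ℂ] 𝓢(EuclideanSpace ℝ (Fin d), ℂ) :=
        SchwartzMap.compCLMOfContinuousLinearEquiv ℂ
          (LinearIsometryEquiv.neg ℝ (E := EuclideanSpace ℝ (Fin d)))
      have hN : ∀ a y, N a y = a (-y) := fun a y => rfl
      have h1 := T.apply_mulS_fourier ψ (ρ.mulS (N (𝓕 h)))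
      have h2 : 𝓕 (ρ.mulS (N (𝓕 h))) = (𝓕⁻ (N ρ)).conv h := by
        have h3 : 𝓕 ((𝓕⁻ (N ρ)).conv h) = N (ρ.mulS (N (𝓕 h))) := by
          ext y
          rw [SchwartzMap.conv, SchwartzMap.fourier_convolution, SchwartzMap.pairing_apply_apply,
            FourierTransform.fourier_fourierInv_eq, hN ρ, hN (ρ.mulS _), SchwartzMap.mulS_apply,
            hN, neg_neg]
          rfl
        have h4 : (𝓕⁻ (N ρ)).conv h = 𝓕⁻ (N (ρ.mulS (N (𝓕 h)))) := by
          rw [← h3, FourierTransform.fourierInv_fourier_eq]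
        rw [h4]
        ext y
        rw [SchwartzMap.fourierInv_coe, SchwartzMap.fourier_coe, Real.fourierInv_eq_fourier_comp_neg]
        refine congrArg (fun u : EuclideanSpace ℝ (Fin d) → ℂ => 𝓕 u y) (funext fun z => ?_)
        rw [hN, neg_neg]
      have h5 : T (ψ.mulS (𝓕 (ρ.mulS (N (𝓕 h))))) = 0 := by
        rw [h2, SchwartzMap.mulS, ← TemperedDistribution.smulLeftCLM_apply_apply,
          ← hS, TemperedDistribution.apply_conv]
        simp [hS0]
      rw [h5] at h1
      simp only [mul_zero, integral_zero]
      rw [h1]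
      refine integral_congr_ae (Filter.Eventually.of_forall fun η => ?_)
      simp only [SchwartzMap.mulS_apply, hN]
      ring
  have h6 := congrFun h0 0
  simp only [neg_zero, SchwartzMap.modulate_zero] at h6
  refine (mul_eq_zero.1 h6).resolve_left ?_
  have h7 : 𝓕 h 0 = ((∫ y, ‖g y‖ ^ 2 : ℝ) : ℂ) := by
    rw [SchwartzMap.fourier_coe, Real.fourier_eq', ← integral_complex_ofReal]
    refine integral_congr_ae (Filter.Eventually.of_forall fun y => ?_)
    simp only [inner_zero_right, mul_zero, Complex.ofReal_zero, zero_mul, Complex.exp_zero,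
      one_smul, hh, SchwartzMap.mulS_apply, SchwartzMap.conj_apply, Complex.conj_mul',
      Complex.ofReal_pow]
  rw [h7, Complex.ofReal_eq_zero]
  have hint : Integrable fun y => ‖g y‖ ^ 2 := by
    have := h.integrable (μ := volume)
    refine this.norm.congr (Filter.Eventually.of_forall fun y => ?_)
    simp [hh, SchwartzMap.mulS_apply, SchwartzMap.conj_apply, sq]
  obtain ⟨y₀, hy₀⟩ : ∃ y, g y ≠ 0 := by
    by_contra! hc
    exact hg (SchwartzMap.ext hc)
  exact (integral_pos_of_integrable_nonneg_nonzero (x := y₀) (by fun_prop) hint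
    (fun y => by positivity) (by positivity)).ne'

end Modulation

/-! ### Removing `ħ` from the norm -/

section WindowNorm

variable {d : ℕ}

/-- The Sjöstrand norm in the normalization of Mathlib's Fourier transform. -/
def windowNorm (g : 𝓢(EuclideanSpace ℝ (Fin d), ℂ)) (f : 𝓢'(EuclideanSpace ℝ (Fin d), ℂ)) : ℝ≥0∞ :=
  ∫⁻ η : EuclideanSpace ℝ (Fin d), ⨆ x : EuclideanSpace ℝ (Fin d),
    ‖f (SchwartzMap.modulate η (SchwartzMap.compSubConstCLM ℂ x g).conj)‖ₑ

theorem conj_phaseShift (ħ : ℝ) (x ξ : EuclideanSpace ℝ (Fin d))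
    (g : 𝓢(EuclideanSpace ℝ (Fin d), ℂ)) :
    (phaseShift ħ x ξ g).conj = (((2 * Real.pi * ħ) ^ (-(d : ℝ) / 2) : ℝ) : ℂ) •
      SchwartzMap.modulate ((2 * Real.pi * ħ)⁻¹ • ξ) (SchwartzMap.compSubConstCLM ℂ x g).conj := by
  ext y
  have h : -(ħ⁻¹ * inner ℝ ξ y) =
      -(2 * Real.pi) * inner ℝ ((2 * Real.pi * ħ)⁻¹ • ξ) y := by
    rw [real_inner_smul_left, mul_inv]
    field_simp
  rw [SchwartzMap.conj_apply, phaseShift_apply, smul_apply, SchwartzMap.modulate_apply,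
    SchwartzMap.conj_apply, SchwartzMap.compSubConstCLM_apply, map_mul, map_mul,
    Complex.conj_ofReal, ← Complex.exp_conj, map_mul, Complex.conj_ofReal, Complex.conj_I, ← h,
    Complex.ofReal_neg, mul_neg, neg_mul, smul_eq_mul]

theorem stft_eq (ħ : ℝ) (g : 𝓢(EuclideanSpace ℝ (Fin d), ℂ))
    (f : 𝓢'(EuclideanSpace ℝ (Fin d), ℂ)) (x ξ : EuclideanSpace ℝ (Fin d)) :
    stft ħ g f x ξ = (((2 * Real.pi * ħ) ^ (-(d : ℝ) / 2) : ℝ) : ℂ) *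
      f (SchwartzMap.modulate ((2 * Real.pi * ħ)⁻¹ • ξ)
        (SchwartzMap.compSubConstCLM ℂ x g).conj) := by
  rw [stft, conj_phaseShift, map_smul, smul_eq_mul]

theorem lintegral_comp_inv_smul {V : Type*} [NormedAddCommGroup V] [NormedSpace ℝ V]
    [FiniteDimensional ℝ V] [MeasurableSpace V] [BorelSpace V] (μ : Measure V) [μ.IsAddHaarMeasure]
    {r : ℝ} (hr : 0 < r) (H : V → ℝ≥0∞) :
    ∫⁻ ξ, H (r⁻¹ • ξ) ∂μ = ENNReal.ofReal (r ^ Module.finrank ℝ V) * ∫⁻ η, H η ∂μ := by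
  have hr' : r⁻¹ ≠ 0 := inv_ne_zero hr.ne'
  have h := lintegral_map_equiv (μ := μ) H (Homeomorph.smulOfNeZero r⁻¹ hr').toMeasurableEquiv
  have h2 : ⇑(Homeomorph.smulOfNeZero r⁻¹ hr').toMeasurableEquiv = fun ξ : V => r⁻¹ • ξ := rfl
  rw [h2] at h
  rw [← h]
  have h3 := Measure.map_addHaar_smul μ hr'
  change Measure.map (fun ξ : V => r⁻¹ • ξ) μ = _ at h3
  rw [h3, lintegral_smul_measure, inv_pow, inv_inv, abs_of_pos (by positivity), smul_eq_mul]

/-- The substitution `ξ = 2πħη` contributes `(2πħ)^d`, and the phase space shift contributes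
`(2πħ)^{-d/2}`. -/
theorem sjostrandNorm_eq {ħ : ℝ} (hħ : 0 < ħ) (g : 𝓢(EuclideanSpace ℝ (Fin d), ℂ))
    (f : 𝓢'(EuclideanSpace ℝ (Fin d), ℂ)) :
    sjostrandNorm ħ g f =
      ENNReal.ofReal ((2 * Real.pi * ħ) ^ ((d : ℝ) / 2)) * windowNorm g f := by
  have hκ : 0 < 2 * Real.pi * ħ := by positivity
  simp only [sjostrandNorm, stft_eq, enorm_mul, ← ENNReal.mul_iSup]
  rw [lintegral_const_mul' _ _ enorm_ne_top,
    lintegral_comp_inv_smul volume hκ fun η => ⨆ x : EuclideanSpace ℝ (Fin d),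
      ‖f (SchwartzMap.modulate η (SchwartzMap.compSubConstCLM ℂ x g).conj)‖ₑ, ← mul_assoc,
    windowNorm]
  congr 1
  rw [← ofReal_norm, Complex.norm_real, Real.norm_of_nonneg (by positivity),
    ← ENNReal.ofReal_mul (by positivity), finrank_euclideanSpace_fin, ← Real.rpow_natCast,
    ← Real.rpow_add hκ]
  congr 2
  ring

theorem sjostrandNorm_lt_top_iff {ħ : ℝ} (hħ : 0 < ħ) (g : 𝓢(EuclideanSpace ℝ (Fin d), ℂ))
    (f : 𝓢'(EuclideanSpace ℝ (Fin d), ℂ)) :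
    sjostrandNorm ħ g f < ⊤ ↔ windowNorm g f < ⊤ := by
  rw [sjostrandNorm_eq hħ]
  have h1 : ENNReal.ofReal ((2 * Real.pi * ħ) ^ ((d : ℝ) / 2)) ≠ 0 := by
    rw [Ne, ENNReal.ofReal_eq_zero, not_le]
    positivity
  constructor
  · exact fun h => (ENNReal.mul_lt_top_iff.1 h).elim And.right
      fun h => h.elim (fun h => absurd h h1) fun h => by simp [h]
  · exact ENNReal.mul_lt_top ENNReal.ofReal_lt_top

end WindowNorm

/-! ### Finite norm implies bounded and continuous -/

section Reconstruction

variable {V : Type*} [NormedAddCommGroup V] [InnerProductSpace ℝ V] [FiniteDimensional ℝ V]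
  [MeasurableSpace V] [BorelSpace V]

theorem integral_fourier_mul_eq_of_integrable {u v : V → ℂ} (hu : Integrable u)
    (hv : Integrable v) : ∫ x, 𝓕 u x * v x = ∫ x, u x * 𝓕 v x := by
  have := VectorFourier.integral_fourierIntegral_smul_eq_flip (μ := (volume : Measure V))
    (ν := (volume : Measure V)) (L := innerₗ V) Real.continuous_fourierChar
    (by exact continuous_inner) hu hv
  rw [flip_innerₗ] at this
  exact this

theorem integral_fourierInv_mul_eq_of_integrable {u v : V → ℂ} (hu : Integrable u)
    (hv : Integrable v) : ∫ x, 𝓕⁻ u x * v x = ∫ x, u x * 𝓕⁻ v x := by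
  have h := integral_fourier_mul_eq_of_integrable hu (v := fun x => v (-x)) hv.comp_neg
  rw [← integral_neg_eq_self] at h
  simp only [neg_neg, ← Real.fourierInv_eq_fourier_neg, ← Real.fourierInv_eq_fourier_comp_neg] at h
  exact h

theorem norm_fourierInv_le (u : V → ℂ) (y : V) : ‖𝓕⁻ u y‖ ≤ ∫ x, ‖u x‖ := by
  rw [Real.fourierInv_eq_fourier_neg]
  exact VectorFourier.norm_fourierIntegral_le_integral_norm _ _ _ _ _

theorem continuous_fourierInv {u : V → ℂ} (hu : Integrable u) : Continuous (𝓕⁻ u) := by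
  have h : Continuous (𝓕 u) := VectorFourier.fourierIntegral_continuous
    Real.continuous_fourierChar (by exact continuous_inner) hu
  have : 𝓕⁻ u = fun y => 𝓕 u (-y) := funext fun y => Real.fourierInv_eq_fourier_neg u y
  rw [this]
  exact h.comp continuous_neg

variable {d : ℕ}

theorem BoundedContinuousFunction.toDistribution_injective :
    Function.Injective
      (BoundedContinuousFunction.toDistribution (d := d)) := fun F G h => by
  have : ⇑F = ⇑G := eq_of_integral_schwartz_mul_eq (μ := volume) F.continuous G.continuous
    fun φ => by
      rw [← BoundedContinuousFunction.toDistribution_apply, h,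
        BoundedContinuousFunction.toDistribution_apply]
  exact DFunLike.coe_injective this

variable (g : 𝓢(EuclideanSpace ℝ (Fin d), ℂ)) (f : 𝓢'(EuclideanSpace ℝ (Fin d), ℂ))

theorem lintegral_apply_modulate_le (x : EuclideanSpace ℝ (Fin d)) :
    ∫⁻ η, ‖f (SchwartzMap.modulate η (SchwartzMap.compSubConstCLM ℂ x g).conj)‖ₑ ≤
      windowNorm g f :=
  lintegral_mono fun η => le_iSup (fun x => ‖f (SchwartzMap.modulate η
    (SchwartzMap.compSubConstCLM ℂ x g).conj)‖ₑ) x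

variable {g f}

theorem integrable_apply_modulate (h : windowNorm g f < ⊤) (x : EuclideanSpace ℝ (Fin d)) :
    Integrable fun η => f (SchwartzMap.modulate η (SchwartzMap.compSubConstCLM ℂ x g).conj) :=
  ⟨(f.continuous_apply_modulate _).aestronglyMeasurable,
    (lintegral_apply_modulate_le g f x).trans_lt h⟩

/-- The localized distribution has an integrable Fourier transform, so Fourier inversion by duality
identifies it with a continuous function. -/
theorem apply_conj_translate_mulS (h : windowNorm g f < ⊤) (x : EuclideanSpace ℝ (Fin d))
    (ψ : 𝓢(EuclideanSpace ℝ (Fin d), ℂ)) :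
    f ((SchwartzMap.compSubConstCLM ℂ x g).conj.mulS ψ) = ∫ y, ψ y *
      𝓕⁻ (fun η => f (SchwartzMap.modulate η (SchwartzMap.compSubConstCLM ℂ x g).conj)) y := by
  have h1 : ψ = 𝓕 (𝓕⁻ ψ) := by rw [FourierTransform.fourier_fourierInv_eq]
  conv_lhs => rw [h1]
  rw [f.apply_mulS_fourier, ← integral_fourierInv_mul_eq_of_integrable ψ.integrable
    (integrable_apply_modulate h x), SchwartzMap.fourierInv_coe]

/-- A tempered distribution of finite Sjöstrand norm is a bounded continuous function. -/
theorem exists_toDistribution_eq (hg : g ≠ 0) (h : windowNorm g f < ⊤) :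
    ∃ F : EuclideanSpace ℝ (Fin d) →ᵇ ℂ, F.toDistribution = f := by
  obtain ⟨y₀, hy₀⟩ : ∃ y, g y ≠ 0 := by
    by_contra! hc
    exact hg (SchwartzMap.ext hc)
  set W : EuclideanSpace ℝ (Fin d) → EuclideanSpace ℝ (Fin d) → ℂ := fun x η =>
    f (SchwartzMap.modulate η (SchwartzMap.compSubConstCLM ℂ x g).conj) with hW
  have hWi : ∀ x, Integrable (W x) := integrable_apply_modulate h
  have hu : ∀ x, Continuous (𝓕⁻ (W x)) := fun x => continuous_fourierInv (hWi x)
  have hub : ∀ x y, ‖𝓕⁻ (W x) y‖ ≤ (windowNorm g f).toReal := fun x y => by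
    refine (norm_fourierInv_le _ _).trans ?_
    rw [integral_norm_eq_lintegral_enorm (hWi x).1]
    exact ENNReal.toReal_mono h.ne (lintegral_apply_modulate_le g f x)
  -- Both sides represent `f` multiplied by the two conjugate windows centred at `x₁` and `x₂`.
  have hglue : ∀ x₁ x₂ y, 𝓕⁻ (W x₁) y * (starRingEnd ℂ) (g (y - x₂)) =
      𝓕⁻ (W x₂) y * (starRingEnd ℂ) (g (y - x₁)) := fun x₁ x₂ => by
    have hgc : ∀ x, Continuous fun y => (starRingEnd ℂ) (g (y - x)) := fun x =>
      Complex.continuous_conj.comp (g.continuous.comp (continuous_sub_right x))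
    refine congrFun (eq_of_integral_schwartz_mul_eq (μ := volume) ((hu x₁).mul (hgc x₂))
      ((hu x₂).mul (hgc x₁)) fun φ => ?_)
    have h1 := apply_conj_translate_mulS h x₁ ((SchwartzMap.compSubConstCLM ℂ x₂ g).conj.mulS φ)
    have h2 := apply_conj_translate_mulS h x₂ ((SchwartzMap.compSubConstCLM ℂ x₁ g).conj.mulS φ)
    have h3 : (SchwartzMap.compSubConstCLM ℂ x₁ g).conj.mulS
        ((SchwartzMap.compSubConstCLM ℂ x₂ g).conj.mulS φ) =
        (SchwartzMap.compSubConstCLM ℂ x₂ g).conj.mulS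
        ((SchwartzMap.compSubConstCLM ℂ x₁ g).conj.mulS φ) := by
      ext y
      simp only [SchwartzMap.mulS_apply]
      ring
    rw [h3, h2] at h1
    simp only [SchwartzMap.mulS_apply, SchwartzMap.conj_apply,
      SchwartzMap.compSubConstCLM_apply] at h1
    refine Eq.trans ?_ (h1.symm.trans ?_) <;>
    · refine integral_congr_ae (Filter.Eventually.of_forall fun y => ?_)
      simp only [hW]
      ring
  -- Centring the window at `y - y₀` makes its value at `y` equal to the fixed number `g y₀ ≠ 0`;
  -- the bound on `F₀` is therefore uniform.
  set F₀ : EuclideanSpace ℝ (Fin d) → ℂ := fun y =>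
    𝓕⁻ (W (y - y₀)) y / (starRingEnd ℂ) (g y₀) with hF₀
  have hgy : (starRingEnd ℂ) (g y₀) ≠ 0 := (map_ne_zero _).2 hy₀
  have hF : ∀ x y, 𝓕⁻ (W x) y = F₀ y * (starRingEnd ℂ) (g (y - x)) := fun x y => by
    have := hglue x (y - y₀) y
    rw [sub_sub_cancel] at this
    rw [hF₀, div_mul_eq_mul_div, ← this, mul_div_cancel_right₀ _ hgy]
  -- The window in the definition of `F₀` moves with the point. Near a given `y`, gluing permits the
  -- window to be frozen at centre `y - y₀`, where it stays nonzero.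
  have hFc : Continuous F₀ := by
    rw [continuous_iff_continuousAt]
    intro y
    have hc : Continuous fun z => (starRingEnd ℂ) (g (z - (y - y₀))) :=
      Complex.continuous_conj.comp (g.continuous.comp (continuous_sub_right _))
    have hne : (starRingEnd ℂ) (g (y - (y - y₀))) ≠ 0 := by rwa [sub_sub_cancel]
    have h1 : ContinuousAt (fun z => 𝓕⁻ (W (y - y₀)) z / (starRingEnd ℂ) (g (z - (y - y₀)))) y :=
      (hu _).continuousAt.div hc.continuousAt hne
    refine h1.congr ?_
    filter_upwards [hc.continuousAt.eventually_ne hne] with z hz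
    rw [hF, mul_div_cancel_right₀ _ hz]
  let F : EuclideanSpace ℝ (Fin d) →ᵇ ℂ := BoundedContinuousFunction.ofNormedAddCommGroup F₀ hFc
    ((windowNorm g f).toReal / ‖(starRingEnd ℂ) (g y₀)‖) fun y => by
      rw [hF₀, norm_div]
      gcongr
      exact hub _ _
  refine ⟨F, sub_eq_zero.1 (TemperedDistribution.eq_zero_of_apply_mulS_translate_eq_zero _ g hg
    fun x ψ => ?_)⟩
  rw [sub_apply, sub_eq_zero, BoundedContinuousFunction.toDistribution_apply,
    apply_conj_translate_mulS h]
  refine integral_congr_ae (Filter.Eventually.of_forall fun y => ?_)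
  change _ = ψ y * 𝓕⁻ (W x) y
  rw [hF]
  change (SchwartzMap.compSubConstCLM ℂ x g).conj.mulS ψ y * F₀ y = _
  rw [SchwartzMap.mulS_apply, SchwartzMap.conj_apply, SchwartzMap.compSubConstCLM_apply]
  ring

end Reconstruction

/-! ### The decomposition of `ℝ^{m+k}` into head and tail -/

section Splitting

variable (m k : ℕ)

/-- The point `(x', x'')` of `ℝ^{m+k}` with given components. -/
def joinHT (a : EuclideanSpace ℝ (Fin m)) (b : EuclideanSpace ℝ (Fin k)) :
    EuclideanSpace ℝ (Fin (m + k)) :=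
  WithLp.toLp 2 (Fin.append (fun i => a i) (fun j => b j))

variable {m k}

theorem joinHT_castAdd (a : EuclideanSpace ℝ (Fin m)) (b : EuclideanSpace ℝ (Fin k)) (i : Fin m) :
    joinHT m k a b (Fin.castAdd k i) = a i := by
  simp [joinHT]

theorem joinHT_natAdd (a : EuclideanSpace ℝ (Fin m)) (b : EuclideanSpace ℝ (Fin k)) (j : Fin k) :
    joinHT m k a b (Fin.natAdd m j) = b j := by
  simp [joinHT]

theorem headCLM_joinHT (a : EuclideanSpace ℝ (Fin m)) (b : EuclideanSpace ℝ (Fin k)) :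
    headCLM m k (joinHT m k a b) = a := by
  ext i
  rw [headCLM_apply, joinHT_castAdd]

theorem tailCLM_joinHT (a : EuclideanSpace ℝ (Fin m)) (b : EuclideanSpace ℝ (Fin k)) :
    tailCLM m k (joinHT m k a b) = b := by
  ext i
  rw [tailCLM_apply, joinHT_natAdd]

theorem joinHT_head_tail (x : EuclideanSpace ℝ (Fin (m + k))) :
    joinHT m k (headCLM m k x) (tailCLM m k x) = x := by
  ext i
  refine Fin.addCases (fun i => ?_) (fun j => ?_) i
  · rw [joinHT_castAdd, headCLM_apply]
  · rw [joinHT_natAdd, tailCLM_apply]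

theorem joinHT_sub (a a' : EuclideanSpace ℝ (Fin m)) (b b' : EuclideanSpace ℝ (Fin k)) :
    joinHT m k a b - joinHT m k a' b' = joinHT m k (a - a') (b - b') := by
  ext i
  refine Fin.addCases (fun i => ?_) (fun j => ?_) i
  · simp [joinHT_castAdd]
  · simp [joinHT_natAdd]

theorem inner_joinHT (a a' : EuclideanSpace ℝ (Fin m)) (b b' : EuclideanSpace ℝ (Fin k)) :
    inner ℝ (joinHT m k a b) (joinHT m k a' b') = inner ℝ a a' + inner ℝ b b' := by
  simp [PiLp.inner_apply, Fin.sum_univ_add, joinHT_castAdd, joinHT_natAdd]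

variable (m k)

/-- The isometry `ℝ^{m+k} = ℝ^m × ℝ^k`. -/
def splitIsometry : EuclideanSpace ℝ (Fin (m + k)) ≃ₗᵢ[ℝ]
    WithLp 2 (EuclideanSpace ℝ (Fin m) × EuclideanSpace ℝ (Fin k)) where
  toFun x := WithLp.toLp 2 (headCLM m k x, tailCLM m k x)
  invFun z := joinHT m k z.fst z.snd
  left_inv x := joinHT_head_tail x
  right_inv z := by
    change WithLp.toLp 2 (headCLM m k (joinHT m k z.fst z.snd),
      tailCLM m k (joinHT m k z.fst z.snd)) = z
    rw [headCLM_joinHT, tailCLM_joinHT]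
    rfl
  map_add' x y := by rw [map_add, map_add]; rfl
  map_smul' c x := by rw [map_smul, map_smul]; rfl
  norm_map' x := by
    change ‖WithLp.toLp 2 (headCLM m k x, tailCLM m k x)‖ = ‖x‖
    rw [← sq_eq_sq₀ (norm_nonneg _) (norm_nonneg _), WithLp.prod_norm_sq_eq_of_L2]
    simp [EuclideanSpace.norm_sq_eq, Fin.sum_univ_add, headCLM_apply, tailCLM_apply]

/-- The measurable equivalence `ℝ^m × ℝ^k = ℝ^{m+k}`. -/
def joinEquiv : EuclideanSpace ℝ (Fin m) × EuclideanSpace ℝ (Fin k) ≃ᵐ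
    EuclideanSpace ℝ (Fin (m + k)) :=
  (MeasurableEquiv.toLp 2 _).trans (splitIsometry m k).symm.toMeasurableEquiv

theorem joinEquiv_apply (z : EuclideanSpace ℝ (Fin m) × EuclideanSpace ℝ (Fin k)) :
    joinEquiv m k z = joinHT m k z.1 z.2 := rfl

theorem volume_preserving_joinEquiv : MeasurePreserving (joinEquiv m k) :=
  (splitIsometry m k).symm.measurePreserving.comp (WithLp.volume_preserving_toLp _ _)

theorem lintegral_joinHT {H : EuclideanSpace ℝ (Fin (m + k)) → ℝ≥0∞} (hH : Measurable H) :
    ∫⁻ x, H x = ∫⁻ a, ∫⁻ b, H (joinHT m k a b) := by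
  rw [← (volume_preserving_joinEquiv m k).lintegral_comp hH, Measure.volume_eq_prod,
    lintegral_prod _ (by fun_prop)]
  rfl

variable {m k}

theorem MeasureTheory.Integrable.comp_joinHT {u : EuclideanSpace ℝ (Fin (m + k)) → ℂ} (hu : Integrable u) :
    Integrable fun z : EuclideanSpace ℝ (Fin m) × EuclideanSpace ℝ (Fin k) =>
      u (joinHT m k z.1 z.2) :=
  ((volume_preserving_joinEquiv m k).integrable_comp_emb
    (joinEquiv m k).measurableEmbedding).2 hu

theorem integral_joinHT {u : EuclideanSpace ℝ (Fin (m + k)) → ℂ} (hu : Integrable u) :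
    ∫ x, u x = ∫ a, ∫ b, u (joinHT m k a b) := by
  rw [← (volume_preserving_joinEquiv m k).integral_comp' u, Measure.volume_eq_prod]
  exact integral_prod _ hu.comp_joinHT

theorem SchwartzMap.tensor_joinHT (g : 𝓢(EuclideanSpace ℝ (Fin m), ℂ))
    (h : 𝓢(EuclideanSpace ℝ (Fin k), ℂ)) (a : EuclideanSpace ℝ (Fin m))
    (b : EuclideanSpace ℝ (Fin k)) : g.tensor h (joinHT m k a b) = g a * h b := by
  rw [SchwartzMap.tensor_apply, headCLM_joinHT, tailCLM_joinHT]

variable (k) in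
/-- The linear isometry `x' ↦ (x', 0)`. -/
def inclHeadIsometry (m : ℕ) :
    EuclideanSpace ℝ (Fin m) →ₗᵢ[ℝ] EuclideanSpace ℝ (Fin (m + k)) where
  toFun a := joinHT m k a 0
  map_add' a b := by
    ext i
    refine Fin.addCases (fun i => ?_) (fun j => ?_) i
    · simp [joinHT_castAdd]
    · simp [joinHT_natAdd]
  map_smul' c a := by
    ext i
    refine Fin.addCases (fun i => ?_) (fun j => ?_) i
    · simp [joinHT_castAdd]
    · simp [joinHT_natAdd]
  norm_map' a := by
    change ‖joinHT m k a 0‖ = ‖a‖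
    rw [← sq_eq_sq₀ (norm_nonneg _) (norm_nonneg _)]
    simp [EuclideanSpace.norm_sq_eq, Fin.sum_univ_add, joinHT_castAdd, joinHT_natAdd]

/-- The slice `x' ↦ G(x', b)` of a Schwartz function. -/
def SchwartzMap.slice (G : 𝓢(EuclideanSpace ℝ (Fin (m + k)), ℂ)) (b : EuclideanSpace ℝ (Fin k)) :
    𝓢(EuclideanSpace ℝ (Fin m), ℂ) :=
  SchwartzMap.compCLMOfAntilipschitz ℂ
    (inclHeadIsometry k m).toContinuousLinearMap.hasTemperateGrowth
    (inclHeadIsometry k m).isometry.antilipschitz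
    (SchwartzMap.compSubConstCLM ℂ (joinHT m k 0 (-b)) G)

theorem SchwartzMap.slice_apply (G : 𝓢(EuclideanSpace ℝ (Fin (m + k)), ℂ))
    (b : EuclideanSpace ℝ (Fin k)) (a : EuclideanSpace ℝ (Fin m)) :
    G.slice b a = G (joinHT m k a b) := by
  change G (joinHT m k a 0 - joinHT m k 0 (-b)) = _
  rw [joinHT_sub, sub_zero, sub_neg_eq_add, zero_add]

end Splitting

/-! ### The restriction inequality -/

section Restriction

/-- By duality against Schwartz functions. Only almost everywhere equality can be expected, because
`w` need not be continuous. -/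
theorem fourier_fourierInv_ae_eq {V : Type*} [NormedAddCommGroup V] [InnerProductSpace ℝ V]
    [FiniteDimensional ℝ V] [MeasurableSpace V] [BorelSpace V] {w : V → ℂ} (hw : Integrable w)
    (hw' : Integrable (𝓕⁻ w)) : 𝓕 (𝓕⁻ w) =ᵐ[volume] w := by
  have hc : Continuous (𝓕 (𝓕⁻ w)) := VectorFourier.fourierIntegral_continuous
    Real.continuous_fourierChar (by exact continuous_inner) hw'
  refine ae_eq_of_integral_schwartz_mul_eq hc.locallyIntegrable hw.locallyIntegrable fun φ => ?_
  rw [← integral_fourier_mul_eq_of_integrable φ.integrable hw', ← SchwartzMap.fourier_coe,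
    ← integral_fourierInv_mul_eq_of_integrable (𝓕 φ).integrable hw, ← SchwartzMap.fourierInv_coe,
    FourierTransform.fourierInv_fourier_eq]

theorem SchwartzMap.continuous_conj {d : ℕ} :
    Continuous (SchwartzMap.conj : 𝓢(EuclideanSpace ℝ (Fin d), ℂ) → _) :=
  (SchwartzMap.postcompCLM (E := EuclideanSpace ℝ (Fin d))
    (Complex.conjCLE : ℂ →L[ℝ] ℂ)).continuous

theorem continuous_apply_modulate_translate {d : ℕ} (g : 𝓢(EuclideanSpace ℝ (Fin d), ℂ))
    (f : 𝓢'(EuclideanSpace ℝ (Fin d), ℂ)) (η : EuclideanSpace ℝ (Fin d)) :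
    Continuous fun x => f (SchwartzMap.modulate η (SchwartzMap.compSubConstCLM ℂ x g).conj) :=
  f.continuous.comp ((SchwartzMap.modulate η).continuous.comp
    (SchwartzMap.continuous_conj.comp g.continuous_compSubConstCLM))

/-- An uncountable supremum of continuous functions is still lower semicontinuous, hence measurable.
-/
theorem measurable_iSup_enorm_apply_modulate {d : ℕ} (g : 𝓢(EuclideanSpace ℝ (Fin d), ℂ))
    (f : 𝓢'(EuclideanSpace ℝ (Fin d), ℂ)) :
    Measurable fun η => ⨆ x : EuclideanSpace ℝ (Fin d),
      ‖f (SchwartzMap.modulate η (SchwartzMap.compSubConstCLM ℂ x g).conj)‖ₑ :=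
  (lowerSemicontinuous_iSup fun _ =>
    (f.continuous_apply_modulate _).enorm.lowerSemicontinuous).measurable

theorem iSup_le_of_dense {X : Type*} [TopologicalSpace X] {s : Set X} (hs : Dense s)
    {u : X → ℝ≥0∞} (hu : Continuous u) {C : ℝ≥0∞} (h : ∀ x ∈ s, u x ≤ C) : ⨆ x, u x ≤ C := by
  refine iSup_le fun x => ?_
  have : closure s ⊆ {x | u x ≤ C} := closure_minimal h (isClosed_le hu continuous_const)
  exact this (hs x)

theorem BoundedContinuousFunction.integrable_mul_conj_translate {d : ℕ}
    (F : EuclideanSpace ℝ (Fin d) →ᵇ ℂ) (g : 𝓢(EuclideanSpace ℝ (Fin d), ℂ))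
    (x : EuclideanSpace ℝ (Fin d)) :
    Integrable fun y => F y * (starRingEnd ℂ) (g (y - x)) :=
  (SchwartzMap.compSubConstCLM ℂ x g).conj.integrable.bdd_mul
    F.continuous.aestronglyMeasurable (Filter.Eventually.of_forall F.norm_coe_le_norm)

theorem BoundedContinuousFunction.toDistribution_modulate_translate {d : ℕ}
    (F : EuclideanSpace ℝ (Fin d) →ᵇ ℂ) (g : 𝓢(EuclideanSpace ℝ (Fin d), ℂ))
    (x η : EuclideanSpace ℝ (Fin d)) :
    F.toDistribution (SchwartzMap.modulate η (SchwartzMap.compSubConstCLM ℂ x g).conj) =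
      𝓕 (fun y => F y * (starRingEnd ℂ) (g (y - x))) η := by
  rw [BoundedContinuousFunction.toDistribution_apply, Real.fourier_eq']
  refine integral_congr_ae (Filter.Eventually.of_forall fun y => ?_)
  simp only [SchwartzMap.modulate_apply, SchwartzMap.conj_apply, SchwartzMap.compSubConstCLM_apply,
    smul_eq_mul, real_inner_comm η y, neg_mul]
  ring

variable {m k : ℕ}

/-- At `(a, 0)` the character does not involve the frequency `ζ`, so Fubini applies. -/
theorem fourierInv_joinHT_zero {W : EuclideanSpace ℝ (Fin (m + k)) → ℂ} (hW : Integrable W)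
    (a : EuclideanSpace ℝ (Fin m)) :
    𝓕⁻ W (joinHT m k a 0) = 𝓕⁻ (fun η => ∫ ζ, W (joinHT m k η ζ)) a := by
  rw [Real.fourierInv_eq, Real.fourierInv_eq, integral_joinHT]
  · refine integral_congr_ae (Filter.Eventually.of_forall fun η => ?_)
    simp only [inner_joinHT, inner_zero_right, add_zero]
    simp only [Circle.smul_def]
    rw [integral_smul]
  · refine hW.norm.mono' ?_ (Filter.Eventually.of_forall fun y => ?_)
    · have h : Continuous fun v => Real.fourierChar (inner ℝ v (joinHT m k a 0)) :=
        Real.continuous_fourierChar.comp (by fun_prop)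
      exact (continuous_induced_dom.comp h).aestronglyMeasurable.smul hW.1
    · rw [Circle.norm_smul]

/-- Only the slice of `G` at height `b` matters. The freedom in `b` and `c` covers both the tensor
window (`b = 0`, `c = g''(0)`) and a slice of an arbitrary window (`c = 1`). -/
theorem windowNorm_restrictHead_le (F : EuclideanSpace ℝ (Fin (m + k)) →ᵇ ℂ)
    {G : 𝓢(EuclideanSpace ℝ (Fin (m + k)), ℂ)} {g : 𝓢(EuclideanSpace ℝ (Fin m), ℂ)} {c : ℂ}
    {b : EuclideanSpace ℝ (Fin k)} (hG : ∀ a, G (joinHT m k a b) = c * g a)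
    (h : windowNorm G F.toDistribution < ⊤) :
    ‖c‖ₑ * windowNorm g (restrictHead m k F).toDistribution ≤ windowNorm G F.toDistribution := by
  set M : EuclideanSpace ℝ (Fin (m + k)) → ℝ≥0∞ := fun η => ⨆ x,
    ‖F.toDistribution (SchwartzMap.modulate η (SchwartzMap.compSubConstCLM ℂ x G).conj)‖ₑ with hM
  have hMm : Measurable M := measurable_iSup_enorm_apply_modulate G F.toDistribution
  have key : ∀ x : EuclideanSpace ℝ (Fin m), ∀ᵐ η : EuclideanSpace ℝ (Fin m),
      ‖c‖ₑ * ‖(restrictHead m k F).toDistribution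
        (SchwartzMap.modulate η (SchwartzMap.compSubConstCLM ℂ x g).conj)‖ₑ ≤
        ∫⁻ ζ, M (joinHT m k η ζ) := by
    intro x
    -- The tail shift `-b` puts the slice of `G` at height `b` over the subspace `x'' = 0`.
    set W : EuclideanSpace ℝ (Fin (m + k)) → ℂ := fun η => F.toDistribution
      (SchwartzMap.modulate η (SchwartzMap.compSubConstCLM ℂ (joinHT m k x (-b)) G).conj) with hW
    have hWi : Integrable W := integrable_apply_modulate h _
    set U : EuclideanSpace ℝ (Fin (m + k)) → ℂ := fun y =>
      F y * (starRingEnd ℂ) (G (y - joinHT m k x (-b))) with hU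
    have hUc : Continuous U := F.continuous.mul (Complex.continuous_conj.comp
      (G.continuous.comp (continuous_sub_right _)))
    have hWU : W = 𝓕 U := funext fun η => F.toDistribution_modulate_translate G _ η
    have hinv : 𝓕⁻ W = U := by
      rw [hWU]
      exact hUc.fourierInv_fourier_eq (F.integrable_mul_conj_translate G _) (hWU ▸ hWi)
    set U' : EuclideanSpace ℝ (Fin m) → ℂ := fun y =>
      restrictHead m k F y * (starRingEnd ℂ) (g (y - x)) with hU'
    set w : EuclideanSpace ℝ (Fin m) → ℂ := fun η => ∫ ζ, W (joinHT m k η ζ) with hw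
    have hwi : Integrable w := hWi.comp_joinHT.integral_prod_left
    have hwU : 𝓕⁻ w = (starRingEnd ℂ) c • U' := by
      ext a
      rw [hw, ← fourierInv_joinHT_zero hWi, hinv, hU, Pi.smul_apply, hU', smul_eq_mul]
      change F (joinHT m k a 0) * _ = _ * (F (joinHT m k a 0) * _)
      rw [joinHT_sub, sub_neg_eq_add, zero_add, hG, map_mul]
      ring
    have hUi : Integrable (𝓕⁻ w) := by
      rw [hwU]
      exact ((restrictHead m k F).integrable_mul_conj_translate g x).smul _
    filter_upwards [fourier_fourierInv_ae_eq hwi hUi] with η hη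
    have h1 : 𝓕 (𝓕⁻ w) η = (starRingEnd ℂ) c * 𝓕 U' η := by
      rw [hwU]
      exact congrFun (VectorFourier.fourierIntegral_const_smul Real.fourierChar volume
        (innerₗ (EuclideanSpace ℝ (Fin m))) U' ((starRingEnd ℂ) c)) η
    rw [(restrictHead m k F).toDistribution_modulate_translate]
    have h2 : ‖c‖ₑ = ‖(starRingEnd ℂ) c‖ₑ := by
      rw [← ofReal_norm, ← ofReal_norm, RCLike.norm_conj]
    rw [h2, ← enorm_mul, ← h1, hη]
    refine (enorm_integral_le_lintegral_enorm _).trans (lintegral_mono fun ζ => ?_)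
    exact le_iSup (fun x => ‖F.toDistribution (SchwartzMap.modulate (joinHT m k η ζ)
      (SchwartzMap.compSubConstCLM ℂ x G).conj)‖ₑ) _
  -- The exceptional null set in `key` depends on `x`. A countable dense set of `x` leaves a single
  -- null set, and continuity in `x` recovers the full supremum.
  obtain ⟨s, hsc, hsd⟩ := TopologicalSpace.exists_countable_dense (EuclideanSpace ℝ (Fin m))
  rw [windowNorm, ← lintegral_const_mul' _ _ enorm_ne_top]
  change _ ≤ ∫⁻ η, M η
  rw [lintegral_joinHT m k hMm]
  refine lintegral_mono_ae ?_
  filter_upwards [(ae_ball_iff hsc).2 fun x _ => key x] with η hη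
  rw [ENNReal.mul_iSup]
  refine iSup_le_of_dense hsd ?_ hη
  exact (ENNReal.continuous_const_mul enorm_ne_top).comp
    (continuous_apply_modulate_translate g _ η).enorm

end Restriction

/-! ### The norm of the constant function `1` -/

section ConstantOne

variable {d : ℕ}

/-- Translating the window changes the Fourier transform of its conjugate by a phase only, so the
supremum over `x` is over a constant. -/
theorem windowNorm_const_one (g : 𝓢(EuclideanSpace ℝ (Fin d), ℂ)) :
    windowNorm g (BoundedContinuousFunction.const _ (1 : ℂ)).toDistribution =
      ∫⁻ η, ‖𝓕 g.conj η‖ₑ := by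
  refine lintegral_congr fun η => ?_
  have h : ∀ x, ‖(BoundedContinuousFunction.const _ (1 : ℂ)).toDistribution
      (SchwartzMap.modulate η (SchwartzMap.compSubConstCLM ℂ x g).conj)‖ₑ = ‖𝓕 g.conj η‖ₑ := by
    intro x
    have h1 : (fun y => (BoundedContinuousFunction.const (EuclideanSpace ℝ (Fin d)) (1 : ℂ)) y *
        (starRingEnd ℂ) (g (y - x))) = SchwartzMap.compSubConstCLM ℂ x g.conj := by
      ext y
      simp [SchwartzMap.conj_apply]
    rw [BoundedContinuousFunction.toDistribution_modulate_translate, h1, ← SchwartzMap.fourier_coe,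
      SchwartzMap.fourier_compSubConstCLM, SchwartzMap.modulate_apply, ← ofReal_norm,
      ← ofReal_norm, norm_mul, Complex.norm_exp_ofReal_mul_I, one_mul]
  simp_rw [h, ciSup_const]

theorem windowNorm_const_one_lt_top (g : 𝓢(EuclideanSpace ℝ (Fin d), ℂ)) :
    windowNorm g (BoundedContinuousFunction.const _ (1 : ℂ)).toDistribution < ⊤ := by
  rw [windowNorm_const_one]
  exact (𝓕 g.conj).integrable.2

theorem windowNorm_const_one_ne_zero {g : 𝓢(EuclideanSpace ℝ (Fin d), ℂ)} (hg : g ≠ 0) :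
    windowNorm g (BoundedContinuousFunction.const _ (1 : ℂ)).toDistribution ≠ 0 := by
  rw [windowNorm_const_one, Ne, lintegral_eq_zero_iff (𝓕 g.conj).continuous.enorm.measurable]
  intro h
  let K : 𝓢(EuclideanSpace ℝ (Fin d), ℂ) := 𝓕 g.conj
  have h1 : ⇑K = fun _ => 0 := by
    refine (K.continuous.ae_eq_iff_eq volume continuous_const).1 ?_
    filter_upwards [h] with η hη
    exact enorm_eq_zero.1 hη
  have h2 : 𝓕 g.conj = (0 : 𝓢(EuclideanSpace ℝ (Fin d), ℂ)) := SchwartzMap.ext (congrFun h1)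
  have h3 : g.conj = 0 := by
    rw [← FourierTransform.fourierInv_fourier_eq (F := 𝓢(EuclideanSpace ℝ (Fin d), ℂ)) g.conj, h2]
    exact map_zero (FourierTransform.fourierInvCLM ℂ 𝓢(EuclideanSpace ℝ (Fin d), ℂ))
  refine hg (SchwartzMap.ext fun y => ?_)
  have h4 : (starRingEnd ℂ) (g y) = 0 := by
    rw [← SchwartzMap.conj_apply, h3]
    rfl
  exact (map_eq_zero _).1 h4

variable {m k : ℕ}

theorem SchwartzMap.conj_tensor (g : 𝓢(EuclideanSpace ℝ (Fin m), ℂ))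
    (h : 𝓢(EuclideanSpace ℝ (Fin k), ℂ)) : (g.tensor h).conj = g.conj.tensor h.conj := by
  ext y
  simp only [SchwartzMap.conj_apply, SchwartzMap.tensor_apply, map_mul]

theorem SchwartzMap.fourier_tensor (g : 𝓢(EuclideanSpace ℝ (Fin m), ℂ))
    (h : 𝓢(EuclideanSpace ℝ (Fin k), ℂ)) (a : EuclideanSpace ℝ (Fin m))
    (b : EuclideanSpace ℝ (Fin k)) : 𝓕 (g.tensor h) (joinHT m k a b) = 𝓕 g a * 𝓕 h b := by
  rw [SchwartzMap.fourier_coe, SchwartzMap.fourier_coe, SchwartzMap.fourier_coe, Real.fourier_eq',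
    Real.fourier_eq', Real.fourier_eq', ← integral_prod_mul, ← Measure.volume_eq_prod,
    ← (volume_preserving_joinEquiv m k).integral_comp']
  refine integral_congr_ae (Filter.Eventually.of_forall fun z => ?_)
  simp only [joinEquiv_apply, inner_joinHT, SchwartzMap.tensor_joinHT, smul_eq_mul, mul_add,
    Complex.ofReal_add, add_mul, Complex.exp_add]
  ring

theorem windowNorm_tensor_const_one (g : 𝓢(EuclideanSpace ℝ (Fin m), ℂ))
    (h : 𝓢(EuclideanSpace ℝ (Fin k), ℂ)) :
    windowNorm (g.tensor h) (BoundedContinuousFunction.const _ (1 : ℂ)).toDistribution =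
      windowNorm g (BoundedContinuousFunction.const _ (1 : ℂ)).toDistribution *
        windowNorm h (BoundedContinuousFunction.const _ (1 : ℂ)).toDistribution := by
  simp only [windowNorm_const_one, SchwartzMap.conj_tensor]
  rw [lintegral_joinHT m k (SchwartzMap.continuous _).enorm.measurable]
  simp only [SchwartzMap.fourier_tensor, enorm_mul]
  simp_rw [lintegral_const_mul' _ _ enorm_ne_top]
  exact lintegral_mul_const _ (SchwartzMap.continuous _).enorm.measurable

theorem SchwartzMap.conj_gaussianWindow {ħ : ℝ} (hħ : 0 < ħ) {q : Fin k → ℝ} (hq : ∀ j, 0 < q j) :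
    (gaussianWindow ħ hħ q hq).conj = gaussianWindow ħ hħ q hq := by
  ext y
  rw [SchwartzMap.conj_apply, gaussianWindow_apply, Complex.conj_ofReal]

/-- Nonnegativity is what makes the `L¹` norm of the transform equal to its integral. -/
theorem exists_fourier_gaussianWindow_eq_ofReal {ħ : ℝ} (hħ : 0 < ħ) {q : Fin k → ℝ}
    (hq : ∀ j, 0 < q j) (η : EuclideanSpace ℝ (Fin k)) :
    ∃ r : ℝ, 0 ≤ r ∧ 𝓕 (gaussianWindow ħ hħ q hq) η = r := by
  set β : Fin k → ℝ := fun j => q j / (2 * ħ) with hβ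
  have hβ0 : ∀ j, 0 < β j := fun j => div_pos (hq j) (by positivity)
  refine ⟨(2 * Real.pi * ħ) ^ (-(k : ℝ) / 2) * ∏ j, ((Real.pi / β j) ^ (1 / 2 : ℝ) *
    Real.exp (-(2 * Real.pi * η j) ^ 2 / (4 * β j))), ?_, ?_⟩
  · have : ∀ j, 0 ≤ (Real.pi / β j) ^ (1 / 2 : ℝ) *
        Real.exp (-(2 * Real.pi * η j) ^ 2 / (4 * β j)) := fun j => by
      have := hβ0 j
      positivity
    exact mul_nonneg (by positivity) (Finset.prod_nonneg fun j _ => this j)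
  · have h1 := GaussianFourier.integral_cexp_neg_sum_mul_add (b := fun j => (β j : ℂ))
      (fun j => by simpa using hβ0 j) fun j => ((-(2 * Real.pi * η j) : ℝ) : ℂ) * Complex.I
    rw [← (EuclideanSpace.volume_preserving_symm_measurableEquiv_toLp (Fin k)).integral_comp'] at h1
    rw [SchwartzMap.fourier_coe, Real.fourier_eq', Complex.ofReal_mul, Complex.ofReal_prod]
    have h2 : ∀ j, ((((Real.pi / β j) ^ (1 / 2 : ℝ) *
        Real.exp (-(2 * Real.pi * η j) ^ 2 / (4 * β j)) : ℝ)) : ℂ) =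
        ((Real.pi : ℂ) / β j) ^ (1 / 2 : ℂ) *
          Complex.exp ((((-(2 * Real.pi * η j) : ℝ) : ℂ) * Complex.I) ^ 2 / (4 * β j)) := by
      intro j
      rw [Complex.ofReal_mul, Complex.ofReal_cpow (by have := hβ0 j; positivity),
        Complex.ofReal_exp]
      congr 1
      · push_cast; rfl
      · rw [mul_pow _ Complex.I, Complex.I_sq]
        congr 1
        push_cast
        ring
    simp_rw [h2]
    rw [← h1, ← integral_const_mul]
    refine integral_congr_ae (Filter.Eventually.of_forall fun y => ?_)
    simp only [gaussianWindow_apply, smul_eq_mul, MeasurableEquiv.toLp_symm_apply]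
    rw [Complex.ofReal_mul ((2 * Real.pi * ħ) ^ (-(k : ℝ) / 2)), Complex.ofReal_exp, mul_left_comm,
      ← Complex.exp_add]
    congr 2
    rw [add_comm]
    congr 1
    · push_cast
      rw [neg_mul, Finset.mul_sum]
      congr 1
      refine Finset.sum_congr rfl fun j _ => ?_
      simp only [hβ]
      push_cast
      ring
    · rw [PiLp.inner_apply]
      push_cast
      rw [Finset.mul_sum, Finset.sum_mul]
      refine Finset.sum_congr rfl fun j _ => ?_
      simp
      ring

theorem gaussianWindow_zero {ħ : ℝ} (hħ : 0 < ħ) {q : Fin k → ℝ} (hq : ∀ j, 0 < q j) :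
    gaussianWindow ħ hħ q hq 0 = (((2 * Real.pi * ħ) ^ (-(k : ℝ) / 2) : ℝ) : ℂ) := by
  rw [gaussianWindow_apply]
  simp

/-- The transform is nonnegative, so its `L¹` norm is its integral, which Fourier inversion at the
origin evaluates as the window at `0`. -/
theorem windowNorm_gaussianWindow_const_one {ħ : ℝ} (hħ : 0 < ħ) {q : Fin k → ℝ}
    (hq : ∀ j, 0 < q j) :
    windowNorm (gaussianWindow ħ hħ q hq)
      (BoundedContinuousFunction.const _ (1 : ℂ)).toDistribution =
        ENNReal.ofReal ((2 * Real.pi * ħ) ^ (-(k : ℝ) / 2)) := by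
  set G := gaussianWindow ħ hħ q hq with hG
  choose r hr hGr using exists_fourier_gaussianWindow_eq_ofReal hħ hq
  have h1 : ∀ η, ‖𝓕 G η‖ = r η := fun η => by
    rw [hG, hGr, Complex.norm_real, Real.norm_of_nonneg (hr η)]
  rw [windowNorm_const_one, SchwartzMap.conj_gaussianWindow,
    ← ofReal_integral_norm_eq_lintegral_enorm (𝓕 G).integrable]
  congr 1
  have h2 : G 0 = ∫ η, 𝓕 G η := by
    conv_lhs => rw [← FourierTransform.fourierInv_fourier_eq (F := 𝓢(EuclideanSpace ℝ (Fin k), ℂ)) G]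
    rw [SchwartzMap.fourierInv_coe, Real.fourierInv_eq']
    simp
  have h4 : ∫ η, 𝓕 G η = ((∫ η, ‖𝓕 G η‖ : ℝ) : ℂ) := by
    rw [← integral_complex_ofReal]
    refine integral_congr_ae (Filter.Eventually.of_forall fun η => ?_)
    change 𝓕 G η = ((‖𝓕 G η‖ : ℝ) : ℂ)
    rw [h1]
    exact hGr η
  rw [hG, gaussianWindow_zero, ← hG, h4] at h2
  exact_mod_cast h2.symm

end ConstantOne

theorem SchwartzMap.tensor_ne_zero {m k : ℕ} {g : 𝓢(EuclideanSpace ℝ (Fin m), ℂ)}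
    {h : 𝓢(EuclideanSpace ℝ (Fin k), ℂ)} (hg : g ≠ 0) (hh : h 0 ≠ 0) : g.tensor h ≠ 0 := by
  obtain ⟨a, ha⟩ : ∃ y, g y ≠ 0 := by
    by_contra! hc
    exact hg (SchwartzMap.ext hc)
  intro h0
  have := SchwartzMap.tensor_joinHT g h a 0
  rw [h0] at this
  exact mul_ne_zero ha hh this.symm

end

/-! ### The restriction theorem and its sharp constant -/

theorem proposition5p2 (ħ : ℝ) (hħ : 0 < ħ) (hħ1 : ħ ≤ 1) (m k : ℕ) (hm : 1 ≤ m) (hk : 1 ≤ k)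
    (g' : 𝓢(EuclideanSpace ℝ (Fin m), ℂ)) (hg' : g' ≠ 0)
    (q : Fin k → ℝ) (hq : ∀ j, 0 < q j) :
    -- every `f` in the class is a bounded continuous function, whose restriction is in the class
    (∀ f : 𝓢'(EuclideanSpace ℝ (Fin (m + k)), ℂ), MemSjostrand ħ f →
      (∃! F : EuclideanSpace ℝ (Fin (m + k)) →ᵇ ℂ, F.toDistribution = f) ∧
      ∀ F : EuclideanSpace ℝ (Fin (m + k)) →ᵇ ℂ, F.toDistribution = f →
        MemSjostrand ħ (restrictHead m k F).toDistribution ∧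
        sjostrandNorm ħ g' (restrictHead m k F).toDistribution ≤
          sjostrandNorm ħ (g'.tensor (gaussianWindow ħ hħ q hq)) f) ∧
    -- the constant `1` in this bound is the best possible
    (∀ C : ℝ≥0∞,
      (∀ F : EuclideanSpace ℝ (Fin (m + k)) →ᵇ ℂ, MemSjostrand ħ F.toDistribution →
        sjostrandNorm ħ g' (restrictHead m k F).toDistribution ≤
          C * sjostrandNorm ħ (g'.tensor (gaussianWindow ħ hħ q hq)) F.toDistribution) →
      1 ≤ C) := by
  have hκ : 0 < 2 * Real.pi * ħ := by positivity
  have hpow : ENNReal.ofReal ((2 * Real.pi * ħ) ^ (((m + k : ℕ) : ℝ) / 2)) *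
      ENNReal.ofReal ((2 * Real.pi * ħ) ^ (-(k : ℝ) / 2)) =
      ENNReal.ofReal ((2 * Real.pi * ħ) ^ ((m : ℝ) / 2)) := by
    rw [← ENNReal.ofReal_mul (by positivity), ← Real.rpow_add hκ]
    congr 2
    push_cast
    ring
  refine ⟨fun f hf => ⟨?_, ?_⟩, fun C hC => ?_⟩
  · obtain ⟨g, hg, hgf⟩ := hf
    obtain ⟨F, hF⟩ := exists_toDistribution_eq hg ((sjostrandNorm_lt_top_iff hħ g f).1 hgf)
    exact ⟨F, hF, fun F' hF' =>
      BoundedContinuousFunction.toDistribution_injective (hF'.trans hF.symm)⟩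
  · rintro F rfl
    refine ⟨?_, ?_⟩
    · obtain ⟨g, hg, hgf⟩ := hf
      obtain ⟨z, hz⟩ : ∃ z, g z ≠ 0 := by
        by_contra! hc
        exact hg (SchwartzMap.ext hc)
      -- A slice of the given window through a point where it is nonzero serves as window on `ℝ^m`.
      -- This avoids proving that the class is independent of the window.
      refine ⟨g.slice (tailCLM m k z), fun h0 => hz ?_, ?_⟩
      · have := SchwartzMap.slice_apply g (tailCLM m k z) (headCLM m k z)
        rw [joinHT_head_tail, h0] at this
        exact this.symm
      · rw [sjostrandNorm_lt_top_iff hħ] at hgf ⊢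
        have := windowNorm_restrictHead_le F (c := 1) (g := g.slice (tailCLM m k z))
          (b := tailCLM m k z) (fun a => by rw [SchwartzMap.slice_apply, one_mul]) hgf
        rw [enorm_one, one_mul] at this
        exact this.trans_lt hgf
    -- Membership gives a finite norm for some window, not necessarily for this one; an infinite
    -- right side is harmless.
    · rcases eq_top_or_lt_top
        (sjostrandNorm ħ (g'.tensor (gaussianWindow ħ hħ q hq)) F.toDistribution) with h | h
      · rw [h]
        exact le_top
      · rw [sjostrandNorm_lt_top_iff hħ] at h
        have h1 := windowNorm_restrictHead_le F (g := g')
          (c := (((2 * Real.pi * ħ) ^ (-(k : ℝ) / 2) : ℝ) : ℂ)) (b := 0)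
          (fun a => by rw [SchwartzMap.tensor_joinHT, gaussianWindow_zero, mul_comm]) h
        rw [← ofReal_norm, Complex.norm_real, Real.norm_of_nonneg (by positivity)] at h1
        rw [sjostrandNorm_eq hħ, sjostrandNorm_eq hħ, ← hpow, mul_assoc]
        gcongr
  · have hne : g'.tensor (gaussianWindow ħ hħ q hq) ≠ 0 := by
      refine SchwartzMap.tensor_ne_zero hg' ?_
      rw [gaussianWindow_zero, Complex.ofReal_ne_zero]
      positivity
    -- The constant function `1` is an extremal: both norms coincide and are finite and nonzero, so
    -- they cancel.
    have h1 := hC (BoundedContinuousFunction.const _ 1)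
      ⟨_, hne, (sjostrandNorm_lt_top_iff hħ _ _).2 (windowNorm_const_one_lt_top _)⟩
    have h2 : restrictHead m k (BoundedContinuousFunction.const _ (1 : ℂ)) =
        BoundedContinuousFunction.const _ 1 := rfl
    have h3 : sjostrandNorm ħ (g'.tensor (gaussianWindow ħ hħ q hq))
        (BoundedContinuousFunction.const _ (1 : ℂ)).toDistribution =
        sjostrandNorm ħ g' (BoundedContinuousFunction.const _ (1 : ℂ)).toDistribution := by
      rw [sjostrandNorm_eq hħ, sjostrandNorm_eq hħ, windowNorm_tensor_const_one,
        windowNorm_gaussianWindow_const_one, mul_comm (windowNorm g' _), ← mul_assoc, hpow]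
    rw [h2, h3] at h1
    have h4 : sjostrandNorm ħ g' (BoundedContinuousFunction.const _ (1 : ℂ)).toDistribution ≠ 0 := by
      rw [sjostrandNorm_eq hħ]
      refine mul_ne_zero ?_ (windowNorm_const_one_ne_zero hg')
      rw [Ne, ENNReal.ofReal_eq_zero, not_le]
      positivity
    have h5 := (sjostrandNorm_lt_top_iff hħ g' _).2 (windowNorm_const_one_lt_top g')
    by_contra! hlt
    have := ENNReal.mul_lt_mul_left h4 h5.ne hlt
    rw [mul_comm] at this
    exact absurd h1 (not_le.2 (by simpa [mul_comm] using this))
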